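/- Let $\lambda,\mu>0$, $0<a<1$, $b=1-a$, and let $M\ge 0$ be an integer. Let $t_0\le t_1\le\cdots$ be the points of a Poisson process on $[0,\infty)$ of intensity $\lambda$, and let the marks $a_0,a_1,\dots$ be i.i.d., independent of the points, with $P\{a_k=n\}=ab^{n-1}$ for $n\ge 1$. Put $A(t)=\sum_{k:\,t_k\le t}a_k$. Let $\Delta_0=0$ and let $\Delta_1,\Delta_2,\dots$ be i.i.d. exponential with parameter $\mu$, the sequence being independent of the process $A$. Put $\tau_n=\Delta_0+\cdots+\Delta_n$, $\tau_{-1}=0$, $A_n=A(\tau_n)$, $\nu=\inf\{n\ge 0: A_n>M\}$ and $K=M+1$ (so that $\nu=\inf\{n:A_n\ge K\}$). For $v\in\mathbb{C}$ with $|v|\le 1$ let $$\gamma(v,0)=E\left[v^{A_1-A_0}\right],\qquad F=\frac{b\mu+\lambda}{\mu+\lambda}\,v .$$ For $x\ge0$ and integers $k\ge 1$ let $P(k,x)=1-\Gamma(k,x)/\Gamma(k)$ be the lower regularized gamma function, where $\Gamma(k,x)=\int_x^\infty s^{k-1}e^{-s}\,ds$, and let $P(0,x)=1$. For $t\ge 0$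 and $j\ge 0$ let $$G_j=b^j\sum_{k=0}^j\binom{j}{k}\left(\frac ab\right)^k\left[P(k,\lambda t)+\frac{\mu}{\lambda}P(k+1,\lambda t)\right],$$ $$H_j=b^{j+1}\sum_{k=0}^j\binom{j}{k}\left(\frac ab\right)^k\left[P(k,\lambda t)+\left(\frac{\mu}{\lambda}+\frac ab\right)P(k+1,\lambda t)\right].$$ Then $\nu<\infty$ almost surely, the random variable $v^{A_\nu}\mathbf 1_{\{t<\tau_{\nu-1}\}}$ is integrable, and for every $t\ge 0$ (empty sums being $0$) $$\begin{aligned} E\left[v^{A_\nu}\mathbf 1_{\{t<\tau_{\nu-1}\}}\right] ={}&\gamma(v,0)\frac{\mu+\lambda}{\lambda}\left[v^{K-1}+(1-F)\sum_{j=0}^{K-2}v^j\right] -\gamma(v,0)\left[v^{K-1}G_{K-1}+\sum_{j=0}^{K-2}\left(v^jG_j-v^{j+1}H_j\right)\right]\\ &-\frac{\mu}{\lambda}\left[\sum_{j=0}^{K-1}v^j\sum_{i=0}^{K-1-j}F^i-(F+bv)\sum_{j=0}^{K-2}v^j\sum_{i=0}^{K-2-j}F^i+bvF\sum_{j=0}^{K-3}v^j\sum_{i=0}^{K-3-j}F^i\right]\\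 &+\frac{\mu}{\mu+\lambda}\left[\sum_{j=0}^{K-1}v^jG_j\sum_{i=0}^{K-1-j}F^i-\sum_{j=0}^{K-2}v^{j+1}(bG_j+H_j)\sum_{i=0}^{K-2-j}F^i+b\sum_{j=0}^{K-3}v^{j+2}H_j\sum_{i=0}^{K-3-j}F^i\right]. \end{aligned}$$ -/

import Mathlib

open MeasureTheory ProbabilityTheory
open scoped NNReal ENNReal

namespace DelayedPassage

section Model

variable {Ω : Type*} [MeasurableSpace Ω]

/-- `N` is the counting process of a homogeneous Poisson point process on `[0, ∞)` of
intensity `lam`: `N t` is the number of points in `[0, t]`. -/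
structure IsPoissonProcess (N : ℝ≥0 → Ω → ℕ) (lam : ℝ≥0) (P : Measure Ω) : Prop where
  measurable : ∀ t, Measurable (N t)
  zero : ∀ ω, N 0 ω = 0
  mono : ∀ ω, Monotone fun t => N t ω
  rightCts : ∀ ω t, ContinuousWithinAt (fun s => N s ω) (Set.Ici t) t
  indepIncrements : HasIndepIncrements N P
  law : ∀ s t, s ≤ t →
    HasLaw (fun ω => N t ω - N s ω) (poissonMeasure (lam * (t - s))) P

/-- The marked process `A(t)`: the sum of the marks of the points in `[0, t]`
(the points are numbered from `0` in increasing order). -/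
def markedProcess (N : ℝ≥0 → Ω → ℕ) (mark : ℕ → Ω → ℕ) (t : ℝ≥0) (ω : Ω) : ℕ :=
  ∑ k ∈ Finset.range (N t ω), mark k ω

/-- The observation epoch `τ_n = Δ_0 + ⋯ + Δ_n`. -/
def obsTime (Δ : ℕ → Ω → ℝ≥0) (n : ℕ) (ω : Ω) : ℝ≥0 :=
  ∑ k ∈ Finset.range (n + 1), Δ k ω

/-- The preceding observation epoch `τ_{n-1} = Δ_0 + ⋯ + Δ_{n-1}`, with `τ_{-1} = 0`. -/
def prevObsTime (Δ : ℕ → Ω → ℝ≥0) (n : ℕ) (ω : Ω) : ℝ≥0 :=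
  ∑ k ∈ Finset.range n, Δ k ω

/-- The observed value `A_n = A(τ_n)`. -/
def obsValue (A : ℝ≥0 → Ω → ℕ) (Δ : ℕ → Ω → ℝ≥0) (n : ℕ) (ω : Ω) : ℕ :=
  A (obsTime Δ n ω) ω

/-- The exit index `ν = inf {n : A_n > M}` of the threshold `M`. -/
noncomputable def exitIndex (A : ℝ≥0 → Ω → ℕ) (Δ : ℕ → Ω → ℝ≥0) (M : ℕ) (ω : Ω) : ℕ :=
  sInf {n | M < obsValue A Δ n ω}

/-- `γ(z, θ) = E[z^{X_1} e^{-θ Δ_1}]` with `X_1 = A_1 - A_0`. -/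
noncomputable def jointTransform (A : ℝ≥0 → Ω → ℕ) (Δ : ℕ → Ω → ℝ≥0) (P : Measure Ω)
    (z θ : ℂ) : ℂ :=
  ∫ ω, z ^ (obsValue A Δ 1 ω - obsValue A Δ 0 ω) * Complex.exp (-θ * ((Δ 1 ω : ℝ) : ℂ)) ∂P

/-- The random variable `v^{A_ν} 1_{t < τ_{ν-1}}`. -/
noncomputable def exitVariable (A : ℝ≥0 → Ω → ℕ) (Δ : ℕ → Ω → ℝ≥0) (M : ℕ) (v : ℂ) (t : ℝ≥0) :
    Ω → ℂ :=
  Set.indicator {ω | t < prevObsTime Δ (exitIndex A Δ M ω) ω}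
    fun ω => v ^ obsValue A Δ (exitIndex A Δ M ω) ω

/-- The special model: a Poisson process of intensity `lam` with independent i.i.d. marks,
geometric on `{1, 2, …}` with parameter `a`; first observation at time `0`, and i.i.d.
exponential inter-observation times of parameter `mu`, independent of the marked process. -/
structure IsModel (N : ℝ≥0 → Ω → ℕ) (mark : ℕ → Ω → ℕ) (Δ : ℕ → Ω → ℝ≥0)
    (a : ℝ) (lam : ℝ≥0) (mu : ℝ) (P : Measure Ω) : Prop where
  poisson : IsPoissonProcess N lam P
  mark_measurable : ∀ k, Measurable (mark k)
  mark_indep : iIndepFun mark P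
  mark_law : ∀ k n, P {ω | mark k ω = n + 1} = ENNReal.ofReal (a * (1 - a) ^ n)
  indep_mark : IndepFun (fun ω t => N t ω) (fun ω k => mark k ω) P
  obs_measurable : ∀ k, Measurable (Δ k)
  obs_zero : ∀ᵐ ω ∂P, Δ 0 ω = 0
  obs_indep : iIndepFun Δ P
  obs_law : ∀ k, 1 ≤ k → HasLaw (fun ω => (Δ k ω : ℝ)) (expMeasure mu) P
  indep_obs : IndepFun (fun ω t => markedProcess N mark t ω) (fun ω k => Δ k ω) P

end Model

section ClosedForm

/-- The regularized lower gamma function `P(k, x) = 1 - Γ(k, x) / Γ(k)` at integers `k ≥ 0`,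
with `P(0, x) = 1`. -/
noncomputable def regGamma : ℕ → ℝ → ℝ
  | 0, _ => 1
  | k + 1, x => 1 - (∫ s in Set.Ioi x, s ^ k * Real.exp (-s)) / Real.Gamma (k + 1)

/-- The coefficient `G_j`, with `b = 1 - a`. -/
noncomputable def coeffG (a lam mu t : ℝ) (j : ℕ) : ℝ :=
  (1 - a) ^ j * ∑ k ∈ Finset.range (j + 1), (j.choose k : ℝ) * (a / (1 - a)) ^ k *
    (regGamma k (lam * t) + mu / lam * regGamma (k + 1) (lam * t))

/-- The coefficient `H_j`, with `b = 1 - a`. -/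
noncomputable def coeffH (a lam mu t : ℝ) (j : ℕ) : ℝ :=
  (1 - a) ^ (j + 1) * ∑ k ∈ Finset.range (j + 1), (j.choose k : ℝ) * (a / (1 - a)) ^ k *
    (regGamma k (lam * t) + (mu / lam + a / (1 - a)) * regGamma (k + 1) (lam * t))

/-- `F(x, v) = (b x + lam) / (x + lam) * v`, with `b = 1 - a`. -/
noncomputable def fracF (a lam x : ℝ) (v : ℂ) : ℂ :=
  ((((1 - a) * x + lam) / (x + lam) : ℝ) : ℂ) * v

/-- The closed form. Here `g` stands for `γ(v, 0)` and `K ≥ 1` is the least observed value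
that counts as a crossing, so `K = M + 1` when a crossing means exceeding `M`.
`S n` is the geometric sum of `F(mu, v)^i` over `0 ≤ i ≤ n - 1`; a sum with upper limit `K - 1`,
`K - 2` or `K - 3` runs over `Finset.range` of `K`, `K - 1` or `K - 2`. -/
noncomputable def closedForm (a lam mu t : ℝ) (g v : ℂ) (K : ℕ) : ℂ :=
  let b : ℂ := ((1 - a : ℝ) : ℂ)
  let l : ℂ := (lam : ℂ)
  let m : ℂ := (mu : ℂ)
  let F : ℂ := fracF a lam mu v
  let G : ℕ → ℂ := fun j => (coeffG a lam mu t j : ℂ)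
  let H : ℕ → ℂ := fun j => (coeffH a lam mu t j : ℂ)
  let S : ℕ → ℂ := fun n => ∑ i ∈ Finset.range n, F ^ i
  g * ((m + l) / l) * (v ^ (K - 1) + (1 - F) * ∑ j ∈ Finset.range (K - 1), v ^ j)
  - g * (v ^ (K - 1) * G (K - 1)
      + ∑ j ∈ Finset.range (K - 1), (v ^ j * G j - v ^ (j + 1) * H j))
  - m / l * (∑ j ∈ Finset.range K, v ^ j * S (K - j)
      - (F + b * v) * ∑ j ∈ Finset.range (K - 1), v ^ j * S (K - 1 - j)
      + b * v * F * ∑ j ∈ Finset.range (K - 2), v ^ j * S (K - 2 - j))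
  + m / (m + l) * (∑ j ∈ Finset.range K, v ^ j * G j * S (K - j)
      - ∑ j ∈ Finset.range (K - 1), v ^ (j + 1) * (b * G j + H j) * S (K - 1 - j)
      + b * ∑ j ∈ Finset.range (K - 2), v ^ (j + 2) * H j * S (K - 2 - j))

end ClosedForm

end DelayedPassage

/-! Split according to the last observed value `i ≤ M` before the crossing and the jump `k > M - i`
that causes it. Since `A` is nondecreasing, a jump from `i` to `i + k` with `k > 0` happens between
at most one pair of consecutive observations. The probability that it happens from an epoch after
`t` is therefore the sum over `m` of the probabilities that `τ_m > t`, `A_m = i` and `A_{m+1} = i +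
k`.

Two facts factor this sum. Increments of `A` are independent and stationary, and `A` is independent
of the epochs, so each term is `P(τ_m > t, A_m = i)` times `incrementProb k`
(`consecutive_obsValue_law`). The epochs `τ_1, τ_2, …` have renewal density constantly `mu`
(`tsum_lintegral_obsTime`), so summing over `m` gives `mu ∫_t^∞ P(A(s) = i) ds`, which is
`occupation i`. This quantity is finite, so by Borel–Cantelli each level is eventually left, and the
crossing is almost sure (`ae_exists_lt_obsValue`).

Summing `incrementProb k * v ^ k` over `k > M - i` leaves `γ(v, 0)` minus a partial sum. The
expectation is thus a finite sum over `i ≤ M`. The rest is algebra (`closedForm_eq_sum`): Pascal's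
rule writes `occupation` through `G` and `H` (`coeffG_succ`), the partial sums are differences of
geometric sums in `F`, and the resulting convolutions are rearranged. -/

namespace DelayedPassage

/-! ### Negative binomial weights. -/

/-- The probability that `n` independent geometric variables on `{1, 2, …}` with parameter `a`
add up to `j`. -/
noncomputable def negBinom (a : ℝ) : ℕ → ℕ → ℝ
  | 0, 0 => 1
  | 0, _ + 1 => 0
  | _ + 1, 0 => 0
  | n + 1, j + 1 => (j.choose n : ℝ) * a ^ (n + 1) * (1 - a) ^ (j - n)

lemma negBinom_nonneg {a : ℝ} (ha0 : 0 < a) (ha1 : a < 1) (n j : ℕ) : 0 ≤ negBinom a n j := by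
  have : 0 < 1 - a := by linarith
  rcases n with _ | n <;> rcases j with _ | j <;> simp only [negBinom] <;> positivity

lemma negBinom_eq_zero_of_lt (a : ℝ) {n j : ℕ} (h : j < n) : negBinom a n j = 0 := by
  rcases n with _ | n
  · omega
  · rcases j with _ | j
    · rfl
    · simp [negBinom, Nat.choose_eq_zero_of_lt (Nat.lt_of_succ_lt_succ h)]

/-- Condition on the first Bernoulli trial when the weight is read as the law of the waiting time
for the last of the required successes; algebraically this is Pascal's rule. -/
lemma negBinom_succ_succ (a : ℝ) (n j : ℕ) :
    negBinom a (n + 1) (j + 1) = (1 - a) * negBinom a (n + 1) j + a * negBinom a n j := by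
  rcases n with _ | n <;> rcases j with _ | j
  · simp [negBinom]
  · simp [negBinom]; ring
  · simp [negBinom]
  · simp only [negBinom]
    rcases Nat.lt_or_ge j (n + 1) with h | h
    · rcases Nat.lt_or_ge j n with h' | h'
      · rw [Nat.choose_eq_zero_of_lt h, Nat.choose_eq_zero_of_lt h',
          Nat.choose_eq_zero_of_lt (by omega : j + 1 < n + 1)]
        simp
      · obtain rfl : j = n := by omega
        simp [Nat.choose_succ_self]
        ring
    · obtain ⟨d, rfl⟩ := Nat.exists_eq_add_of_le h
      rw [Nat.choose_succ_succ, show n + 1 + d + 1 - (n + 1) = d + 1 by omega,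
        show n + 1 + d - (n + 1) = d by omega, show n + 1 + d - n = d + 1 by omega]
      push_cast
      ring

/-- Both sides obey the recurrence `negBinom_succ_succ` in the second argument, so induction on `j`
replaces a summation identity for binomial coefficients. -/
lemma sum_antidiagonal_negBinom_one (a : ℝ) (n j : ℕ) :
    ∑ p ∈ Finset.HasAntidiagonal.antidiagonal j, negBinom a n p.1 * negBinom a 1 p.2 = negBinom a (n + 1) j := by
  induction j with
  | zero => simp [negBinom]
  | succ j ih =>
    rw [Finset.Nat.sum_antidiagonal_succ', negBinom_succ_succ, ← ih, Finset.mul_sum]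
    have h : ∀ i, negBinom a 1 (i + 1) = (1 - a) * negBinom a 1 i + a * negBinom a 0 i :=
      fun i => negBinom_succ_succ a 0 i
    have h0 : ∑ p ∈ Finset.HasAntidiagonal.antidiagonal j, negBinom a n p.1 * negBinom a 0 p.2
        = negBinom a n j := by
      rw [Finset.sum_eq_single (j, 0)]
      · simp [negBinom]
      · rintro ⟨p, q⟩ hp hne
        rcases q with _ | q
        · simp only [Finset.HasAntidiagonal.mem_antidiagonal] at hp
          exact absurd (by simp; omega) hne
        · simp [negBinom]
      · simp
    rw [← h0, Finset.mul_sum, ← Finset.sum_add_distrib]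
    have hz : negBinom a 1 0 = 0 := rfl
    simp only [h, hz, mul_zero, zero_add]
    refine Finset.sum_congr rfl fun p _ => ?_
    ring

/-! ### Laws of the marked process at deterministic times. -/

section

variable {Ω : Type*} [MeasurableSpace Ω] {P : Measure Ω}

lemma measure_add_eq {X Y : Ω → ℕ} (hX : Measurable X) (hY : Measurable Y) (h : IndepFun X Y P)
    (j : ℕ) :
    P {ω | X ω + Y ω = j} =
      ∑ p ∈ Finset.HasAntidiagonal.antidiagonal j, P {ω | X ω = p.1} * P {ω | Y ω = p.2} := by
  have hset : {ω | X ω + Y ω = j} =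
      ⋃ p ∈ Finset.HasAntidiagonal.antidiagonal j, X ⁻¹' {p.1} ∩ Y ⁻¹' {p.2} := by
    ext ω
    simp
  rw [hset, measure_biUnion_finset]
  · exact Finset.sum_congr rfl fun p _ =>
      h.measure_inter_preimage_eq_mul _ _ (measurableSet_singleton _) (measurableSet_singleton _)
  · rintro p - q - hne
    refine Set.disjoint_left.2 ?_
    rintro ω ⟨h1, h2⟩ ⟨h3, h4⟩
    simp only [Set.mem_preimage, Set.mem_singleton_iff] at h1 h2 h3 h4
    exact hne (Prod.ext (h1.symm.trans h3) (h2.symm.trans h4))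
  · exact fun p _ => (hX (measurableSet_singleton _)).inter (hY (measurableSet_singleton _))

/-- A measure is the sum of its values on the fibres of a countably valued map. -/
lemma measure_eq_tsum_fiber {ι : Type*} [Countable ι] [MeasurableSpace ι]
    [MeasurableSingletonClass ι] {Z : Ω → ι} (hZ : Measurable Z) {E : Set Ω}
    (hE : MeasurableSet E) : P E = ∑' i, P (E ∩ Z ⁻¹' {i}) := by
  rw [← measure_iUnion]
  · congr 1
    ext ω
    simp
  · intro i j hij
    refine Set.disjoint_left.2 ?_
    rintro ω ⟨-, h1⟩ ⟨-, h2⟩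
    exact hij (h1.symm.trans h2)
  · exact fun i => hE.inter (hZ (measurableSet_singleton i))

variable {a mu : ℝ} {lam : ℝ≥0} {N : ℝ≥0 → Ω → ℕ} {mark : ℕ → Ω → ℕ} {Δ : ℕ → Ω → ℝ≥0}

/-- The hypothesis prescribes masses only on the positive integers. They already add up to `1`,
which forces mass zero at `0`. -/
lemma mark_law_negBinom [IsProbabilityMeasure P] (ha0 : 0 < a) (ha1 : a < 1)
    {X : Ω → ℕ} (hX : Measurable X)
    (hlaw : ∀ n, P {ω | X ω = n + 1} = ENNReal.ofReal (a * (1 - a) ^ n)) (j : ℕ) :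
    P {ω | X ω = j} = ENNReal.ofReal (negBinom a 1 j) := by
  have hb : 0 < 1 - a := by linarith
  rcases j with _ | j
  · have h1 : P Set.univ = ∑' i, P (Set.univ ∩ X ⁻¹' {i}) := measure_eq_tsum_fiber hX .univ
    rw [measure_univ, tsum_eq_zero_add' ENNReal.summable] at h1
    have h2 : ∑' n : ℕ, P (Set.univ ∩ X ⁻¹' {n + 1}) = 1 := by
      have hs : HasSum (fun n : ℕ => a * (1 - a) ^ n) 1 := by
        have := (hasSum_geometric_of_lt_one hb.le (by linarith : 1 - a < 1)).mul_left a
        rwa [sub_sub_cancel, mul_inv_cancel₀ ha0.ne'] at this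
      rw [← ENNReal.ofReal_one, ← hs.tsum_eq,
        ENNReal.ofReal_tsum_of_nonneg (fun n => by positivity) hs.summable]
      refine tsum_congr fun n => ?_
      rw [← hlaw n, Set.univ_inter]
      rfl
    rw [h2] at h1
    have h3 : P (Set.univ ∩ X ⁻¹' {0}) = 0 := by
      by_contra hne
      have : (1 : ℝ≥0∞) < P (Set.univ ∩ X ⁻¹' {0}) + 1 := by
        rw [add_comm]
        exact ENNReal.lt_add_right ENNReal.one_ne_top hne
      exact this.ne h1
    rw [Set.univ_inter] at h3
    simp only [negBinom, ENNReal.ofReal_zero]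
    exact h3
  · rw [hlaw]
    simp [negBinom]

lemma mark_sum_law [IsProbabilityMeasure P] (ha0 : 0 < a) (ha1 : a < 1)
    (hm : ∀ k, Measurable (mark k)) (hi : iIndepFun mark P)
    (hlaw : ∀ k n, P {ω | mark k ω = n + 1} = ENNReal.ofReal (a * (1 - a) ^ n)) (s n j : ℕ) :
    P {ω | ∑ l ∈ Finset.range n, mark (s + l) ω = j} = ENNReal.ofReal (negBinom a n j) := by
  induction n generalizing j with
  | zero => rcases j with _ | j <;> simp [negBinom]
  | succ n ih =>
    have hi' : iIndepFun (fun l => mark (s + l)) P :=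
      hi.precomp (g := fun l => s + l) (add_right_injective s)
    have hind := hi'.indepFun_sum_range_succ (fun l => hm (s + l)) n
    have hfun : (∑ l ∈ Finset.range n, mark (s + l)) =
        fun ω => ∑ l ∈ Finset.range n, mark (s + l) ω := by
      ext ω; simp
    rw [hfun] at hind
    simp only [Finset.sum_range_succ]
    rw [measure_add_eq (Finset.measurable_fun_sum _ fun l _ => hm (s + l)) (hm (s + n)) hind,
      ← sum_antidiagonal_negBinom_one, ENNReal.ofReal_sum_of_nonneg]
    · refine Finset.sum_congr rfl fun p _ => ?_
      rw [ih, mark_law_negBinom ha0 ha1 (hm _) (hlaw _),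
        ENNReal.ofReal_mul (negBinom_nonneg ha0 ha1 _ _)]
    · exact fun p _ => mul_nonneg (negBinom_nonneg ha0 ha1 _ _) (negBinom_nonneg ha0 ha1 _ _)

/-- Sums over disjoint blocks of indices are independent, and a shift of the block does not change
its law. -/
lemma mark_blocks_law [IsProbabilityMeasure P] (ha0 : 0 < a) (ha1 : a < 1)
    (hm : ∀ k, Measurable (mark k)) (hi : iIndepFun mark P)
    (hlaw : ∀ k n, P {ω | mark k ω = n + 1} = ENNReal.ofReal (a * (1 - a) ^ n)) (n m i k : ℕ) :
    P {ω | ∑ l ∈ Finset.range n, mark l ω = i ∧ ∑ l ∈ Finset.range m, mark (n + l) ω = k} =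
      ENNReal.ofReal (negBinom a n i) * ENNReal.ofReal (negBinom a m k) := by
  have hdisj : Disjoint (Finset.range n) (Finset.Ico n (n + m)) := by
    refine Finset.disjoint_left.2 fun x hx hx' => ?_
    simp only [Finset.mem_range, Finset.mem_Ico] at hx hx'
    omega
  have h := (hi.indepFun_finset _ _ hdisj hm).comp
    (φ := fun x => ∑ l, x l) (ψ := fun x => ∑ l, x l)
    (Finset.measurable_fun_sum _ fun l _ => measurable_pi_apply l)
    (Finset.measurable_fun_sum _ fun l _ => measurable_pi_apply l)
  have h' := h.measure_inter_preimage_eq_mul {i} {k} (measurableSet_singleton _)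
    (measurableSet_singleton _)
  have e1 : ∀ ω, ∑ l : Finset.range n, mark l ω = ∑ l ∈ Finset.range n, mark l ω :=
    fun ω => Finset.sum_coe_sort (Finset.range n) fun l => mark l ω
  have e2 : ∀ ω, ∑ l : Finset.Ico n (n + m), mark l ω =
      ∑ l ∈ Finset.range m, mark (n + l) ω := by
    intro ω
    rw [Finset.sum_coe_sort (Finset.Ico n (n + m)) fun l => mark l ω, Finset.sum_Ico_eq_sum_range]
    simp
  have l1 := mark_sum_law ha0 ha1 hm hi hlaw 0 n i
  simp only [zero_add] at l1
  rw [← l1, ← mark_sum_law ha0 ha1 hm hi hlaw n m k]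
  simp only [Set.preimage, Function.comp_apply, Set.mem_singleton_iff, e1, e2] at h'
  exact h'

/-- The probability that a compound Poisson variable with rate `x` and geometric marks of
parameter `a` takes the value `k`. -/
noncomputable def compoundProb (a x : ℝ) (k : ℕ) : ℝ :=
  ∑ n ∈ Finset.range (k + 1), Real.exp (-x) * x ^ n / n.factorial * negBinom a n k

lemma compoundProb_nonneg (ha0 : 0 < a) (ha1 : a < 1) {x : ℝ} (hx : 0 ≤ x) (k : ℕ) :
    0 ≤ compoundProb a x k :=
  Finset.sum_nonneg fun n _ => mul_nonneg (by positivity) (negBinom_nonneg ha0 ha1 n k)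

/-- Marks are at least `1`, so more than `k` points cannot add up to `k` and the series is finite.
-/
lemma tsum_poisson_mul_negBinom (ha0 : 0 < a) (ha1 : a < 1) (r : ℝ≥0) (k : ℕ) :
    ∑' n, poissonMeasure r {n} * ENNReal.ofReal (negBinom a n k) =
      ENNReal.ofReal (compoundProb a r k) := by
  rw [compoundProb, ENNReal.ofReal_sum_of_nonneg
    (fun n _ => mul_nonneg (by positivity) (negBinom_nonneg ha0 ha1 n k)),
    tsum_eq_sum (s := Finset.range (k + 1))]
  · refine Finset.sum_congr rfl fun n _ => ?_
    rw [poissonMeasure_singleton, ENNReal.ofReal_mul (by positivity)]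
  · intro n hn
    rw [negBinom_eq_zero_of_lt a (by simpa using hn)]
    simp

lemma IsModel.measurable_path_apply (h : IsModel N mark Δ a lam mu P) (t : ℝ≥0) :
    Measurable (markedProcess N mark t) := by
  have : Measurable fun p : ℕ × (ℕ → ℕ) => ∑ k ∈ Finset.range p.1, p.2 k :=
    measurable_from_prod_countable_right fun n =>
      Finset.measurable_fun_sum (Finset.range n) fun k _ => measurable_pi_apply k
  exact this.comp ((h.poisson.measurable t).prodMk (measurable_pi_lambda _ h.mark_measurable))

/-- The two-point law of the marked process. -/
lemma IsModel.two_point_law [IsProbabilityMeasure P] (h : IsModel N mark Δ a lam mu P)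
    (ha0 : 0 < a) (ha1 : a < 1) {s u : ℝ≥0} (hsu : s ≤ u) (i k : ℕ) :
    P {ω | markedProcess N mark s ω = i ∧ markedProcess N mark u ω = i + k} =
      ENNReal.ofReal (compoundProb a (lam * s) i) *
        ENNReal.ofReal (compoundProb a (lam * (u - s)) k) := by
  have hNs := h.poisson.measurable s
  have hNu := h.poisson.measurable u
  have hmono : ∀ ω, N s ω ≤ N u ω := fun ω => h.poisson.mono ω hsu
  have hlaw_s : ∀ n, P {ω | N s ω = n} = poissonMeasure (lam * s) {n} := by
    intro n
    have := (h.poisson.law 0 s (zero_le)).measure_eq (p := fun x => x = n)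
      (measurableSet_singleton n)
    simpa [h.poisson.zero] using this
  have hlaw_u : ∀ m, P {ω | N u ω - N s ω = m} = poissonMeasure (lam * (u - s)) {m} := by
    intro m
    exact (h.poisson.law s u hsu).measure_eq (p := fun x => x = m) (measurableSet_singleton m)
  have hN : ∀ n m, P {ω | N s ω = n ∧ N u ω - N s ω = m} =
      poissonMeasure (lam * s) {n} * poissonMeasure (lam * (u - s)) {m} := by
    intro n m
    have hind := h.poisson.indepIncrements.indepFun_sub_sub (zero_le : 0 ≤ s) hsu
    have := hind.measure_inter_preimage_eq_mul {n} {m} (measurableSet_singleton _)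
      (measurableSet_singleton _)
    rw [← hlaw_s, ← hlaw_u]
    simp only [Set.preimage, Pi.sub_apply, h.poisson.zero, Nat.sub_zero,
      Set.mem_singleton_iff] at this
    exact this
  -- Given `n` points up to `s` and `m` more up to `u`, the two increments use the disjoint mark
  -- blocks `[0, n)` and `[n, n + m)`.
  have hfib : ∀ n m,
      P ({ω | markedProcess N mark s ω = i ∧ markedProcess N mark u ω = i + k} ∩
        (fun ω => (N s ω, N u ω - N s ω)) ⁻¹' {(n, m)}) =
      (poissonMeasure (lam * s) {n} * ENNReal.ofReal (negBinom a n i)) *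
        (poissonMeasure (lam * (u - s)) {m} * ENNReal.ofReal (negBinom a m k)) := by
    intro n m
    have hset : {ω | markedProcess N mark s ω = i ∧ markedProcess N mark u ω = i + k} ∩
        (fun ω => (N s ω, N u ω - N s ω)) ⁻¹' {(n, m)} =
        {ω | N s ω = n ∧ N u ω - N s ω = m} ∩
        {ω | ∑ l ∈ Finset.range n, mark l ω = i ∧
          ∑ l ∈ Finset.range m, mark (n + l) ω = k} := by
      ext ω
      simp only [Set.mem_inter_iff, Set.mem_ofPred_eq, Set.mem_preimage, Set.mem_singleton_iff,
        Prod.mk.injEq, markedProcess]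
      have hle := hmono ω
      constructor
      · rintro ⟨⟨h1, h2⟩, h3, h4⟩
        refine ⟨⟨h3, h4⟩, ?_⟩
        rw [show N u ω = n + m by omega, Finset.sum_range_add] at h2
        rw [h3] at h1
        exact ⟨h1, by omega⟩
      · rintro ⟨⟨h3, h4⟩, h1, h2⟩
        refine ⟨⟨by rw [h3]; exact h1, ?_⟩, h3, h4⟩
        rw [show N u ω = n + m by omega, Finset.sum_range_add]
        omega
    have hind := h.indep_mark.comp
      (φ := fun x : ℝ≥0 → ℕ => (x s, x u - x s))
      (ψ := fun x : ℕ → ℕ => (∑ l ∈ Finset.range n, x l, ∑ l ∈ Finset.range m, x (n + l)))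
      (by fun_prop)
      ((Finset.measurable_fun_sum _ fun l _ => measurable_pi_apply l).prodMk
        (Finset.measurable_fun_sum _ fun l _ => measurable_pi_apply _))
    have hmul := hind.measure_inter_preimage_eq_mul {(n, m)} {(i, k)} (measurableSet_singleton _)
      (measurableSet_singleton _)
    simp only [Set.preimage, Function.comp_apply, Set.mem_singleton_iff, Prod.mk.injEq] at hmul
    rw [hset, hmul, hN, mark_blocks_law ha0 ha1 h.mark_measurable h.mark_indep h.mark_law]
    ring
  have hE : MeasurableSet
      {ω | markedProcess N mark s ω = i ∧ markedProcess N mark u ω = i + k} :=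
    ((h.measurable_path_apply s) (measurableSet_singleton i)).inter
      ((h.measurable_path_apply u) (measurableSet_singleton (i + k)))
  have e1 : ((lam * s : ℝ≥0) : ℝ) = lam * s := by push_cast; rfl
  have e2 : ((lam * (u - s) : ℝ≥0) : ℝ) = lam * (u - s) := by
    push_cast [NNReal.coe_sub hsu]; rfl
  have hZ : Measurable fun ω => (N s ω, N u ω - N s ω) := hNs.prodMk (hNu.sub hNs)
  rw [measure_eq_tsum_fiber hZ hE,
    ENNReal.tsum_prod']
  simp only [hfib]
  simp_rw [ENNReal.tsum_mul_left, ENNReal.tsum_mul_right]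
  rw [tsum_poisson_mul_negBinom ha0 ha1, tsum_poisson_mul_negBinom ha0 ha1, e1, e2]

end

/-! ### Evaluating a right-continuous path at a random time. -/

section RandomTime

/-- The least point of the grid `(n + 1)⁻¹ ℕ` that is strictly larger than `s`. -/
noncomputable def gridTime (n : ℕ) (s : ℝ≥0) : ℝ≥0 :=
  ((⌊s * (n + 1)⌋₊ : ℝ≥0) + 1) / (n + 1)

lemma lt_gridTime (n : ℕ) (s : ℝ≥0) : s < gridTime n s := by
  rw [gridTime, lt_div_iff₀ (by positivity)]
  exact Nat.lt_floor_add_one _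

lemma gridTime_le (n : ℕ) (s : ℝ≥0) : gridTime n s ≤ s + 1 / (n + 1) := by
  have h : (0 : ℝ≥0) < n + 1 := by positivity
  rw [gridTime, div_le_iff₀ h, add_mul, div_mul_cancel₀ _ h.ne']
  gcongr
  exact Nat.floor_le (by positivity)

lemma tendsto_gridTime (s : ℝ≥0) :
    Filter.Tendsto (fun n => gridTime n s) Filter.atTop (nhdsWithin s (Set.Ici s)) := by
  refine tendsto_nhdsWithin_iff.2 ⟨?_, .of_forall fun n => (lt_gridTime n s).le⟩
  refine tendsto_of_tendsto_of_tendsto_of_le_of_le tendsto_const_nhds ?_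
    (fun n => (lt_gridTime n s).le) (fun n => gridTime_le n s)
  have := (tendsto_one_div_add_atTop_nhds_zero_nat (𝕜 := ℝ≥0)).const_add s
  rwa [add_zero] at this

/-- The set of pairs of a path and a time such that the path takes the value `i` right after
that time. -/
def rightValueSet (i : ℕ) : Set ((ℝ≥0 → ℕ) × ℝ≥0) :=
  {p | ∀ᶠ n in Filter.atTop, p.1 (gridTime n p.2) = i}

/-- Evaluation of an arbitrary path at a variable time need not be jointly measurable. Each
`gridTime n` takes countably many values, so evaluation there is. -/
lemma measurableSet_rightValueSet (i : ℕ) : MeasurableSet (rightValueSet i) := by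
  have hset : rightValueSet i = ⋃ k, ⋂ n, ⋂ (_ : k ≤ n),
      {p : (ℝ≥0 → ℕ) × ℝ≥0 | p.1 (gridTime n p.2) = i} := by
    ext p
    simp [rightValueSet]
  rw [hset]
  refine .iUnion fun k => .iInter fun n => .iInter fun _ => ?_
  have h1 : Measurable fun p : (ℝ≥0 → ℕ) × ℕ => p.1 (((p.2 : ℝ≥0) + 1) / (n + 1)) :=
    measurable_from_prod_countable_left fun m =>
      measurable_pi_apply (((m : ℝ≥0) + 1) / (n + 1))
  have h2 : Measurable fun p : (ℝ≥0 → ℕ) × ℝ≥0 => (p.1, ⌊p.2 * (n + 1)⌋₊) :=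
    measurable_fst.prodMk (Nat.measurable_floor.comp (measurable_snd.mul_const _))
  exact (h1.comp h2) (measurableSet_singleton i)

/-- The grid times decrease into `s` from the right within `1 / (n + 1)`, and convergence in the
discrete space `ℕ` means being eventually constant. -/
lemma mem_rightValueSet_iff {x : ℝ≥0 → ℕ} {s : ℝ≥0} (h : ContinuousWithinAt x (Set.Ici s) s)
    (i : ℕ) : (x, s) ∈ rightValueSet i ↔ x s = i := by
  have h' : ∀ᶠ n in Filter.atTop, x (gridTime n s) = x s := by
    have := h.tendsto.comp (tendsto_gridTime s)
    rw [nhds_discrete] at this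
    exact Filter.tendsto_pure.1 this
  constructor
  · intro hi
    obtain ⟨n, h1, h2⟩ := (h'.and hi).exists
    exact h1.symm.trans h2
  · rintro rfl
    exact h'

end RandomTime

/-! ### The marked process at the observation epochs. -/

section

variable {Ω : Type*} [MeasurableSpace Ω] {P : Measure Ω}
  {a mu : ℝ} {lam : ℝ≥0} {N : ℝ≥0 → Ω → ℕ} {mark : ℕ → Ω → ℕ} {Δ : ℕ → Ω → ℝ≥0}

lemma IsModel.rightCts_path (h : IsModel N mark Δ a lam mu P) (ω : Ω) (s : ℝ≥0) :
    ContinuousWithinAt (fun t => markedProcess N mark t ω) (Set.Ici s) s := by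
  have h1 := h.poisson.rightCts ω s
  have h2 : Continuous fun n => ∑ k ∈ Finset.range n, mark k ω := continuous_of_discreteTopology
  exact h2.continuousAt.comp_continuousWithinAt h1

lemma IsModel.monotone_path (h : IsModel N mark Δ a lam mu P) (ω : Ω) :
    Monotone fun t => markedProcess N mark t ω := fun _ _ hst =>
  Finset.sum_le_sum_of_subset (Finset.range_mono (h.poisson.mono ω hst))

lemma IsModel.setOf_path_eq (h : IsModel N mark Δ a lam mu P) (τ : Ω → ℝ≥0) (i : ℕ) :
    {ω | markedProcess N mark (τ ω) ω = i} =
      (fun ω => (fun t => markedProcess N mark t ω, τ ω)) ⁻¹' rightValueSet i := by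
  ext ω
  exact (mem_rightValueSet_iff (h.rightCts_path ω (τ ω)) i).symm

lemma IsModel.measurable_path (h : IsModel N mark Δ a lam mu P) :
    Measurable fun ω t => markedProcess N mark t ω :=
  measurable_pi_lambda _ h.measurable_path_apply

lemma IsModel.measurable_path_comp (h : IsModel N mark Δ a lam mu P)
    {τ : Ω → ℝ≥0} (hτ : Measurable τ) : Measurable fun ω => markedProcess N mark (τ ω) ω := by
  refine measurable_to_countable' fun i => ?_
  change MeasurableSet {ω | markedProcess N mark (τ ω) ω = i}
  rw [h.setOf_path_eq]
  exact (h.measurable_path.prodMk hτ) (measurableSet_rightValueSet i)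

/-- The law of the marked process at two ordered times that are determined by `Δ`. -/
lemma IsModel.random_two_point_law [IsProbabilityMeasure P] (h : IsModel N mark Δ a lam mu P)
    (ha0 : 0 < a) (ha1 : a < 1) {σ ρ : (ℕ → ℝ≥0) → ℝ≥0} (hσ : Measurable σ) (hρ : Measurable ρ)
    (hσρ : ∀ δ, σ δ ≤ ρ δ) {B : Set (ℕ → ℝ≥0)} (hB : MeasurableSet B) (i k : ℕ) :
    P {ω | (fun n => Δ n ω) ∈ B ∧ markedProcess N mark (σ fun n => Δ n ω) ω = i ∧
        markedProcess N mark (ρ fun n => Δ n ω) ω = i + k} =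
      ∫⁻ ω, (B.indicator (fun δ => ENNReal.ofReal (compoundProb a (lam * σ δ) i) *
        ENNReal.ofReal (compoundProb a (lam * (ρ δ - σ δ)) k)) fun n => Δ n ω) ∂P := by
  have hΔ : Measurable fun ω n => Δ n ω := measurable_pi_lambda _ h.obs_measurable
  let Q : Set ((ℝ≥0 → ℕ) × (ℕ → ℝ≥0)) :=
    {p | p.2 ∈ B ∧ (p.1, σ p.2) ∈ rightValueSet i ∧ (p.1, ρ p.2) ∈ rightValueSet (i + k)}
  have hQ : MeasurableSet Q :=
    (measurable_snd hB).inter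
      (((measurable_fst.prodMk (hσ.comp measurable_snd)) (measurableSet_rightValueSet i)).inter
        ((measurable_fst.prodMk (hρ.comp measurable_snd)) (measurableSet_rightValueSet (i + k))))
  have hset : {ω | (fun n => Δ n ω) ∈ B ∧ markedProcess N mark (σ fun n => Δ n ω) ω = i ∧
        markedProcess N mark (ρ fun n => Δ n ω) ω = i + k} =
      (fun ω => (fun t => markedProcess N mark t ω, fun n => Δ n ω)) ⁻¹' Q := by
    ext ω
    exact and_congr Iff.rfl (and_congr
      (mem_rightValueSet_iff (h.rightCts_path ω _) i).symm
      (mem_rightValueSet_iff (h.rightCts_path ω _) (i + k)).symm)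
  have hpm : IsProbabilityMeasure (P.map fun ω t => markedProcess N mark t ω) :=
    Measure.isProbabilityMeasure_map h.measurable_path.aemeasurable
  have hpm' : IsProbabilityMeasure (P.map fun ω n => Δ n ω) :=
    Measure.isProbabilityMeasure_map hΔ.aemeasurable
  -- Independence makes the joint law of path and `Δ` a product; by Tonelli `Δ` can be frozen, and
  -- the law at fixed times applies.
  rw [hset, ← Measure.map_apply (h.measurable_path.prodMk hΔ) hQ,
    h.indep_obs.map_prod_eq_prod_map_map h.measurable_path.aemeasurable hΔ.aemeasurable,
    Measure.prod_apply_symm hQ, lintegral_map (measurable_measure_prodMk_right hQ) hΔ]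
  refine lintegral_congr fun ω => ?_
  rw [Measure.map_apply h.measurable_path (measurable_prodMk_right hQ)]
  by_cases hω : (fun n => Δ n ω) ∈ B
  · rw [Set.indicator_of_mem hω, ← h.two_point_law ha0 ha1 (hσρ _) i k]
    congr 1
    ext ω'
    exact ⟨fun hq => ⟨(mem_rightValueSet_iff (h.rightCts_path ω' _) i).1 hq.2.1,
        (mem_rightValueSet_iff (h.rightCts_path ω' _) (i + k)).1 hq.2.2⟩,
      fun hq => ⟨hω, (mem_rightValueSet_iff (h.rightCts_path ω' _) i).2 hq.1,
        (mem_rightValueSet_iff (h.rightCts_path ω' _) (i + k)).2 hq.2⟩⟩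
  · rw [Set.indicator_of_notMem hω]
    refine measure_mono_null (t := ∅) (fun ω' hq => hω hq.1) measure_empty

lemma continuous_compoundProb (a : ℝ) (k : ℕ) : Continuous fun x => compoundProb a x k := by
  unfold compoundProb
  fun_prop

lemma compoundProb_zero_zero (a : ℝ) : compoundProb a 0 0 = 1 := by
  simp [compoundProb, negBinom]

lemma IsModel.measurable_obsTime (h : IsModel N mark Δ a lam mu P) (m : ℕ) :
    Measurable (obsTime Δ m) :=
  Finset.measurable_fun_sum _ fun k _ => h.obs_measurable k

lemma IsModel.measurable_obsValue (h : IsModel N mark Δ a lam mu P) (m : ℕ) :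
    Measurable (obsValue (markedProcess N mark) Δ m) :=
  h.measurable_path_comp (h.measurable_obsTime m)

lemma IsModel.monotone_obsValue (h : IsModel N mark Δ a lam mu P) (ω : Ω) :
    Monotone fun m => obsValue (markedProcess N mark) Δ m ω := fun _ _ hmn =>
  h.monotone_path ω
    (Finset.sum_le_sum_of_subset (Finset.range_mono (Nat.add_le_add_right hmn 1)))

lemma IsModel.obsValue_law [IsProbabilityMeasure P] (h : IsModel N mark Δ a lam mu P)
    (ha0 : 0 < a) (ha1 : a < 1) (m i : ℕ) :
    P {ω | obsValue (markedProcess N mark) Δ m ω = i} =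
      ∫⁻ ω, ENNReal.ofReal (compoundProb a (lam * obsTime Δ m ω) i) ∂P := by
  have hσ : Measurable fun δ : ℕ → ℝ≥0 => ∑ k ∈ Finset.range (m + 1), δ k := by fun_prop
  -- The one-point law is the case of equal times and increment `0`, whose second factor is
  -- `compoundProb a 0 0 = 1`.
  have := h.random_two_point_law ha0 ha1 hσ hσ (fun _ => le_rfl) (B := Set.univ) .univ i 0
  simp only [Set.mem_univ, true_and, add_zero, and_self, Set.indicator_univ, sub_self, mul_zero,
    compoundProb_zero_zero, ENNReal.ofReal_one, mul_one] at this
  exact this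

lemma IsModel.indepFun_obsTime (h : IsModel N mark Δ a lam mu P) (m : ℕ) :
    IndepFun (obsTime Δ m) (Δ (m + 1)) P := by
  have := h.obs_indep.indepFun_sum_range_succ h.obs_measurable (m + 1)
  rwa [show (∑ j ∈ Finset.range (m + 1), Δ j) = obsTime Δ m by ext ω; simp [obsTime]] at this

/-- The second factor of the two-point law depends only on `τ_{m+1} - τ_m = Δ_{m+1}`, which is
independent of `τ_m`; hence the integral splits. -/
lemma IsModel.consecutive_obsValue_law [IsProbabilityMeasure P]
    (h : IsModel N mark Δ a lam mu P) (ha0 : 0 < a) (ha1 : a < 1) {T : Set ℝ≥0}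
    (hT : MeasurableSet T) (m i k : ℕ) :
    P {ω | obsTime Δ m ω ∈ T ∧ obsValue (markedProcess N mark) Δ m ω = i ∧
        obsValue (markedProcess N mark) Δ (m + 1) ω = i + k} =
      (∫⁻ ω, T.indicator (fun s => ENNReal.ofReal (compoundProb a (lam * s) i))
        (obsTime Δ m ω) ∂P) *
      ∫⁻ x, ENNReal.ofReal (compoundProb a (lam * x) k) ∂(expMeasure mu) := by
  have hσ : ∀ m, Measurable fun δ : ℕ → ℝ≥0 => ∑ k ∈ Finset.range (m + 1), δ k := by
    intro m; fun_prop
  have hlaw := h.random_two_point_law ha0 ha1 (hσ m) (hσ (m + 1))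
    (fun δ => Finset.sum_le_sum_of_subset (Finset.range_mono (Nat.le_succ _)))
    (hσ m hT) i k
  have hind := h.indepFun_obsTime m
  have hw : ∀ i, Measurable fun s : ℝ≥0 => ENNReal.ofReal (compoundProb a (lam * s) i) := fun i =>
    ((continuous_compoundProb a i).measurable.comp
      (measurable_const.mul measurable_coe_nnreal_real)).ennreal_ofReal
  have hw' : Measurable fun x : ℝ => ENNReal.ofReal (compoundProb a (lam * x) k) :=
    ((continuous_compoundProb a k).measurable.comp
      (measurable_const.mul measurable_id)).ennreal_ofReal
  have hlast : ∫⁻ ω, ENNReal.ofReal (compoundProb a (lam * Δ (m + 1) ω) k) ∂P =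
      ∫⁻ x, ENNReal.ofReal (compoundProb a (lam * x) k) ∂(expMeasure mu) :=
    (h.obs_law (m + 1) (by omega)).lintegral_comp hw'.aemeasurable
  have hmul := lintegral_mul_eq_lintegral_mul_lintegral_of_indepFun''
    (((hw i).indicator hT).comp (h.measurable_obsTime m)).aemeasurable
    ((hw k).comp (h.obs_measurable (m + 1))).aemeasurable
    (hind.comp ((hw i).indicator hT) (hw k))
  rw [← hlast]
  refine (Eq.trans hlaw (lintegral_congr fun ω => ?_)).trans hmul
  simp only [Function.comp_apply]
  by_cases hω : obsTime Δ m ω ∈ T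
  · rw [Set.indicator_of_mem hω, Set.indicator_of_mem (by exact hω)]
    simp only [obsTime]
    congr 4
    rw [Finset.sum_range_succ _ (m + 1)]
    push_cast
    ring
  · rw [Set.indicator_of_notMem hω, Set.indicator_of_notMem (by exact hω), zero_mul]

end

/-! ### Erlang laws and the renewal measure of the epochs. -/

section Renewal

lemma lintegral_expMeasure (mu : ℝ) {f : ℝ → ℝ≥0∞} (hf : Measurable f) :
    ∫⁻ x, f x ∂(expMeasure mu) =
      ∫⁻ x in Set.Ioi 0, f x * ENNReal.ofReal (mu * Real.exp (-(mu * x))) := by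
  have h1 : expMeasure mu = volume.withDensity (exponentialPDF mu) := rfl
  have hm : Measurable (exponentialPDF mu) :=
    (measurable_exponentialPDFReal mu).ennreal_ofReal
  rw [h1, lintegral_withDensity_eq_lintegral_mul _ hm hf, ← lintegral_indicator measurableSet_Ioi]
  refine lintegral_congr_ae ?_
  have h0 : ∀ᵐ x : ℝ, x ≠ 0 := by simp [ae_iff]
  filter_upwards [h0] with x hx
  rcases lt_or_gt_of_ne hx with h | h
  · simp [exponentialPDF_of_neg h, not_lt.2 h.le]
  · simp [exponentialPDF_of_nonneg h.le, h, mul_comm]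

/-- The density of the sum of `m + 1` independent exponential variables of rate `mu`. -/
noncomputable def erlangDensity (mu : ℝ) (m : ℕ) (s : ℝ) : ℝ :=
  mu * ((mu * s) ^ m / m.factorial) * Real.exp (-(mu * s))

lemma continuous_erlangDensity (mu : ℝ) (m : ℕ) : Continuous (erlangDensity mu m) := by
  unfold erlangDensity
  fun_prop

lemma erlangDensity_nonneg {mu s : ℝ} (hmu : 0 < mu) (hs : 0 ≤ s) (m : ℕ) :
    0 ≤ erlangDensity mu m s := by
  unfold erlangDensity
  positivity

lemma lintegral_Ioo_erlangDensity {mu u : ℝ} (hmu : 0 < mu) (hu : 0 < u) (m : ℕ) :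
    ∫⁻ s in Set.Ioo 0 u, ENNReal.ofReal (erlangDensity mu m s) *
      ENNReal.ofReal (mu * Real.exp (-(mu * (u - s)))) =
      ENNReal.ofReal (erlangDensity mu (m + 1) u) := by
  have hfun : ∀ s ∈ Set.Ioo 0 u, ENNReal.ofReal (erlangDensity mu m s) *
      ENNReal.ofReal (mu * Real.exp (-(mu * (u - s)))) =
      ENNReal.ofReal (mu ^ (m + 2) / m.factorial * Real.exp (-(mu * u)) * s ^ m) := by
    intro s hs
    rw [← ENNReal.ofReal_mul (erlangDensity_nonneg hmu hs.1.le m), erlangDensity]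
    congr 1
    have : Real.exp (-(mu * u)) = Real.exp (-(mu * s)) * Real.exp (-(mu * (u - s))) := by
      rw [← Real.exp_add]; ring_nf
    rw [this]
    ring
  rw [setLIntegral_congr_fun measurableSet_Ioo hfun, ← ofReal_integral_eq_lintegral_ofReal]
  · congr 1
    rw [← integral_Ioc_eq_integral_Ioo, ← intervalIntegral.integral_of_le hu.le,
      intervalIntegral.integral_const_mul, integral_pow, erlangDensity, Nat.factorial_succ]
    push_cast
    field_simp
    ring
  · refine (Continuous.integrableOn_Icc (a := 0) (b := u) ?_).mono_set Set.Ioo_subset_Icc_self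
    fun_prop
  · refine (ae_restrict_mem measurableSet_Ioo).mono fun s hs => ?_
    have := hs.1
    simp only [Pi.zero_apply]
    positivity

/-- Substitute `u = s + x` and apply Tonelli. The indicator of `0 < s < u` in `g` extends both
integrals to the whole line, where translation invariance is available. -/
lemma lintegral_erlang_conv {mu : ℝ} (hmu : 0 < mu) (m : ℕ) {f : ℝ → ℝ≥0∞} (hf : Measurable f) :
    ∫⁻ s in Set.Ioi 0, (∫⁻ x, f (s + x) ∂(expMeasure mu)) * ENNReal.ofReal (erlangDensity mu m s) =
      ∫⁻ u in Set.Ioi 0, f u * ENNReal.ofReal (erlangDensity mu (m + 1) u) := by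
  let g : ℝ → ℝ → ℝ≥0∞ := fun s u =>
    (Set.Ioo 0 u).indicator (fun s => ENNReal.ofReal (erlangDensity mu m s) *
      ENNReal.ofReal (mu * Real.exp (-(mu * (u - s))))) s
  have hd := (continuous_erlangDensity mu m).measurable
  have hg : Measurable fun p : ℝ × ℝ => f p.2 * g p.1 p.2 := by
    refine (hf.comp measurable_snd).mul ?_
    have hS : MeasurableSet {p : ℝ × ℝ | p.1 ∈ Set.Ioo 0 p.2} :=
      (measurableSet_lt measurable_const measurable_fst).inter
        (measurableSet_lt measurable_fst measurable_snd)
    have hk : Measurable fun p : ℝ × ℝ => ENNReal.ofReal (erlangDensity mu m p.1) *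
      ENNReal.ofReal (mu * Real.exp (-(mu * (p.2 - p.1)))) := by fun_prop
    exact hk.indicator hS
  have h1 : ∀ s, (Set.Ioi 0).indicator (fun s => (∫⁻ x, f (s + x) ∂(expMeasure mu)) *
      ENNReal.ofReal (erlangDensity mu m s)) s = ∫⁻ u, f u * g s u := by
    intro s
    by_cases hs : 0 < s
    · rw [Set.indicator_of_mem (by exact hs),
        lintegral_expMeasure mu (f := fun x => f (s + x)) (hf.comp (measurable_const_add s)),
        ← lintegral_indicator measurableSet_Ioi,
        ← lintegral_mul_const' _ _ ENNReal.ofReal_ne_top,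
        ← lintegral_add_left_eq_self (fun u => f u * g s u) s]
      refine lintegral_congr fun x => ?_
      by_cases hx : 0 < x
      · simp only [g]
        rw [Set.indicator_of_mem (by exact hx),
          Set.indicator_of_mem (by exact ⟨hs, by linarith⟩)]
        rw [add_sub_cancel_left]
        ring
      · simp only [g]
        rw [Set.indicator_of_notMem (by exact hx),
          Set.indicator_of_notMem (fun h => hx (by linarith [h.2]))]
        simp
    · rw [Set.indicator_of_notMem (by exact hs)]
      have : ∀ u, f u * g s u = 0 := by
        intro u
        simp only [g]
        rw [Set.indicator_of_notMem (fun h => hs h.1), mul_zero]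
      simp [this]
  rw [← lintegral_indicator measurableSet_Ioi, lintegral_congr h1,
    lintegral_lintegral_swap hg.aemeasurable, ← lintegral_indicator measurableSet_Ioi]
  refine lintegral_congr fun u => ?_
  have hgu : Measurable fun s => g s u := by
    refine Measurable.indicator ?_ measurableSet_Ioo
    fun_prop
  rw [lintegral_const_mul _ hgu]
  simp only [g]
  rw [lintegral_indicator measurableSet_Ioo]
  by_cases hu : 0 < u
  · rw [Set.indicator_of_mem (by exact hu), lintegral_Ioo_erlangDensity hmu hu]
  · rw [Set.indicator_of_notMem (by exact hu), Set.Ioo_eq_empty hu]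
    simp

variable {Ω : Type*} [MeasurableSpace Ω] {P : Measure Ω}
  {a mu : ℝ} {lam : ℝ≥0} {N : ℝ≥0 → Ω → ℕ} {mark : ℕ → Ω → ℕ} {Δ : ℕ → Ω → ℝ≥0}

lemma IsModel.lintegral_obsTime_succ [IsProbabilityMeasure P] (h : IsModel N mark Δ a lam mu P)
    (hmu : 0 < mu) (m : ℕ) {f : ℝ → ℝ≥0∞} (hf : Measurable f) :
    ∫⁻ ω, f (obsTime Δ (m + 1) ω) ∂P =
      ∫⁻ s in Set.Ioi 0, f s * ENNReal.ofReal (erlangDensity mu m s) := by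
  induction m generalizing f with
  | zero =>
    -- As `Δ_0 = 0` almost surely, `τ_{m+1}` is a sum of `m + 1` exponentials, not `m + 2`.
    have h1 : ∫⁻ ω, f (obsTime Δ 1 ω) ∂P = ∫⁻ ω, f (Δ 1 ω) ∂P := by
      refine lintegral_congr_ae ?_
      filter_upwards [h.obs_zero] with ω hω
      simp [obsTime, Finset.sum_range_succ, hω]
    rw [h1, (h.obs_law 1 le_rfl).lintegral_comp (f := f) hf.aemeasurable, lintegral_expMeasure mu hf]
    simp [erlangDensity]
  | succ m ih =>
    have hprob := isProbabilityMeasure_expMeasure hmu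
    have hτ : Measurable fun ω => (obsTime Δ (m + 1) ω : ℝ) :=
      measurable_coe_nnreal_real.comp (h.measurable_obsTime _)
    have hx : Measurable fun ω => (Δ (m + 2) ω : ℝ) :=
      measurable_coe_nnreal_real.comp (h.obs_measurable _)
    have hind : IndepFun (fun ω => (obsTime Δ (m + 1) ω : ℝ)) (fun ω => (Δ (m + 2) ω : ℝ)) P :=
      (h.indepFun_obsTime (m + 1)).comp measurable_coe_nnreal_real measurable_coe_nnreal_real
    have hf2 : Measurable fun p : ℝ × ℝ => f (p.1 + p.2) := hf.comp (by fun_prop)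
    have h1 : ∫⁻ ω, f (obsTime Δ (m + 2) ω) ∂P =
        ∫⁻ ω, ∫⁻ x, f (obsTime Δ (m + 1) ω + x) ∂(expMeasure mu) ∂P := by
      have e : ∀ ω, (obsTime Δ (m + 2) ω : ℝ) = obsTime Δ (m + 1) ω + Δ (m + 2) ω := by
        intro ω
        rw [obsTime, Finset.sum_range_succ, NNReal.coe_add]
        rfl
      have e' := lintegral_map (μ := P) hf2 (hτ.prodMk hx)
      rw [hind.map_prod_eq_prod_map_map hτ.aemeasurable hx.aemeasurable,
        (h.obs_law (m + 2) (by omega)).map_eq, lintegral_prod _ hf2.aemeasurable,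
        lintegral_map hf2.lintegral_prod_right' hτ] at e'
      rw [e']
      exact lintegral_congr fun ω => by rw [e]
    rw [h1, ih hf2.lintegral_prod_right', lintegral_erlang_conv hmu m hf]

/-- The renewal measure of the observation epochs `τ_1, τ_2, …` has density `mu`. -/
lemma IsModel.tsum_lintegral_obsTime [IsProbabilityMeasure P] (h : IsModel N mark Δ a lam mu P)
    (hmu : 0 < mu) {f : ℝ → ℝ≥0∞} (hf : Measurable f) :
    ∑' m, ∫⁻ ω, f (obsTime Δ (m + 1) ω) ∂P =
      ENNReal.ofReal mu * ∫⁻ s in Set.Ioi 0, f s := by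
  simp_rw [h.lintegral_obsTime_succ hmu _ hf]
  have hm : ∀ m, Measurable fun s => f s * ENNReal.ofReal (erlangDensity mu m s) := fun m =>
    hf.mul (continuous_erlangDensity mu m).measurable.ennreal_ofReal
  rw [← lintegral_tsum fun m => (hm m).aemeasurable, ← lintegral_const_mul _ hf]
  refine setLIntegral_congr_fun measurableSet_Ioi fun s hs => ?_
  have hs' : 0 ≤ s := le_of_lt hs
  -- The Erlang densities are `mu` times Poisson weights, so the exponential series cancels the
  -- factor `exp (-(mu * s))`.
  have hsum : HasSum (fun m => erlangDensity mu m s) mu := by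
    have h1 := NormedSpace.expSeries_div_hasSum_exp (mu * s)
    have h2 := (h1.mul_left mu).mul_right (Real.exp (-(mu * s)))
    rwa [← Real.exp_eq_exp_ℝ, mul_assoc, ← Real.exp_add, add_neg_cancel, Real.exp_zero,
      mul_one] at h2
  rw [ENNReal.tsum_mul_left, ← ENNReal.ofReal_tsum_of_nonneg
    (fun m => erlangDensity_nonneg hmu hs' m) hsum.summable, hsum.tsum_eq, mul_comm]

end Renewal

/-! ### Incomplete gamma integrals, occupation and increment weights. -/

section Integrals

lemma integrableOn_pow_mul_exp_neg (n : ℕ) {x : ℝ} (hx : 0 ≤ x) :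
    IntegrableOn (fun s => s ^ n * Real.exp (-s)) (Set.Ioi x) := by
  have h := Real.GammaIntegral_convergent (s := n + 1) (by positivity)
  refine IntegrableOn.mono_set ?_ (Set.Ioi_subset_Ioi hx)
  refine h.congr_fun (fun s _ => ?_) measurableSet_Ioi
  simp only [add_sub_cancel_right, Real.rpow_natCast]
  ring

lemma integral_Ioi_pow_mul_exp_neg (n : ℕ) (x : ℝ) :
    ∫ s in Set.Ioi x, s ^ n * Real.exp (-s) = n.factorial * (1 - regGamma (n + 1) x) := by
  have : (n.factorial : ℝ) ≠ 0 := by positivity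
  rw [regGamma, Real.Gamma_nat_eq_factorial]
  field_simp
  ring

lemma regGamma_succ_zero (n : ℕ) : regGamma (n + 1) 0 = 0 := by
  have h := Real.Gamma_eq_integral (s := n + 1) (by positivity)
  rw [regGamma, h, sub_eq_zero, eq_comm]
  have e : ∫ s in Set.Ioi (0 : ℝ), s ^ n * Real.exp (-s) =
      ∫ s in Set.Ioi (0 : ℝ), Real.exp (-s) * s ^ ((n : ℝ) + 1 - 1) := by
    refine setIntegral_congr_fun measurableSet_Ioi fun s _ => ?_
    simp only [add_sub_cancel_right, Real.rpow_natCast]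
    ring
  rw [e]
  refine div_self ?_
  rw [← h]
  exact (Real.Gamma_pos_of_pos (by positivity)).ne'

lemma integrableOn_poisson_term {r t : ℝ} (hr : 0 < r) (ht : 0 ≤ t) (n : ℕ) :
    IntegrableOn (fun s => (r * s) ^ n * Real.exp (-(r * s))) (Set.Ioi t) :=
  (integrableOn_Ioi_comp_mul_left_iff (fun s => s ^ n * Real.exp (-s)) t hr).2
    (integrableOn_pow_mul_exp_neg n (by positivity))

lemma integral_poisson_term {r : ℝ} (hr : 0 < r) (t : ℝ) (n : ℕ) :
    ∫ s in Set.Ioi t, (r * s) ^ n * Real.exp (-(r * s)) =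
      n.factorial * (1 - regGamma (n + 1) (r * t)) / r := by
  rw [integral_comp_mul_left_Ioi (fun s => s ^ n * Real.exp (-s)) t hr,
    integral_Ioi_pow_mul_exp_neg, smul_eq_mul]
  ring

lemma regGamma_succ_le_one (n : ℕ) {x : ℝ} (hx : 0 ≤ x) : regGamma (n + 1) x ≤ 1 := by
  have h := integral_Ioi_pow_mul_exp_neg n x
  have h0 : 0 ≤ ∫ s in Set.Ioi x, s ^ n * Real.exp (-s) := by
    refine setIntegral_nonneg measurableSet_Ioi fun s hs => ?_
    have : 0 ≤ s := hx.trans (le_of_lt hs)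
    positivity
  rw [h] at h0
  have := nonneg_of_mul_nonneg_right h0 (by positivity)
  linarith

/-- The expected number of observations after time `t` at which the observed value is `j`. -/
noncomputable def occupation (a lam mu t : ℝ) (j : ℕ) : ℝ :=
  mu / lam * ∑ n ∈ Finset.range (j + 1), negBinom a n j * (1 - regGamma (n + 1) (lam * t))

variable {a lam mu t : ℝ}

lemma occupation_nonneg (ha0 : 0 < a) (ha1 : a < 1) (hlam : 0 < lam) (hmu : 0 < mu) (ht : 0 ≤ t)
    (j : ℕ) : 0 ≤ occupation a lam mu t j :=
  mul_nonneg (by positivity) (Finset.sum_nonneg fun n _ => mul_nonneg (negBinom_nonneg ha0 ha1 n j)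
    (sub_nonneg.2 (regGamma_succ_le_one n (by positivity))))

/-- Integrate the finite sum term by term: the tail integral of the `n`-th Poisson weight is an
upper incomplete gamma function of order `n + 1`. -/
lemma lintegral_compoundProb (ha0 : 0 < a) (ha1 : a < 1) (hlam : 0 < lam) (hmu : 0 < mu)
    (ht : 0 ≤ t) (j : ℕ) :
    ENNReal.ofReal mu * ∫⁻ s in Set.Ioi t, ENNReal.ofReal (compoundProb a (lam * s) j) =
      ENNReal.ofReal (occupation a lam mu t j) := by
  have hterm : ∀ s, compoundProb a (lam * s) j = ∑ n ∈ Finset.range (j + 1),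
      negBinom a n j / n.factorial * ((lam * s) ^ n * Real.exp (-(lam * s))) := fun s =>
    Finset.sum_congr rfl fun n _ => by ring
  have hint : ∀ n ∈ Finset.range (j + 1), IntegrableOn (fun s =>
      negBinom a n j / n.factorial * ((lam * s) ^ n * Real.exp (-(lam * s)))) (Set.Ioi t) :=
    fun n _ => (integrableOn_poisson_term hlam ht n).const_mul _
  rw [← ofReal_integral_eq_lintegral_ofReal, ← ENNReal.ofReal_mul hmu.le]
  · congr 1
    simp_rw [hterm]
    rw [integral_finsetSum _ hint, occupation, Finset.mul_sum, Finset.mul_sum]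
    refine Finset.sum_congr rfl fun n _ => ?_
    rw [integral_const_mul, integral_poisson_term hlam]
    have : (n.factorial : ℝ) ≠ 0 := by positivity
    field_simp
  · simp_rw [hterm]
    exact integrable_finsetSum _ hint
  · refine (ae_restrict_mem measurableSet_Ioi).mono fun s hs => ?_
    exact compoundProb_nonneg ha0 ha1 (mul_nonneg hlam.le (ht.trans (le_of_lt hs))) j

/-- The probability that the marked process grows by `k` between consecutive observations. -/
noncomputable def incrementProb (a lam mu : ℝ) : ℕ → ℝ
  | 0 => mu / (mu + lam)
  | k + 1 => mu / (mu + lam) * (a * lam / (mu + lam)) * (((1 - a) * mu + lam) / (mu + lam)) ^ k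

lemma incrementProb_nonneg (ha0 : 0 < a) (ha1 : a < 1) (hlam : 0 < lam) (hmu : 0 < mu) (k : ℕ) :
    0 ≤ incrementProb a lam mu k := by
  have : 0 < 1 - a := by linarith
  rcases k with _ | k <;> simp only [incrementProb] <;> positivity

/-- The number of points in an exponential interval is geometric with ratio `lam / (mu + lam)`. For
`k > 0`, summing over it is the binomial expansion of `(a * (lam / (mu + lam)) + (1 - a)) ^ (k -
1)`. -/
lemma sum_negBinom_mul_pow (hlam : 0 < lam) (hmu : 0 < mu) (k : ℕ) :
    ∑ n ∈ Finset.range (k + 1), mu / (mu + lam) * (negBinom a n k * (lam / (mu + lam)) ^ n) =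
      incrementProb a lam mu k := by
  have hr : mu + lam ≠ 0 := by positivity
  rw [← Finset.mul_sum]
  rcases k with _ | k
  · simp [negBinom, incrementProb]
  · have hf : ((1 - a) * mu + lam) / (mu + lam) = a * (lam / (mu + lam)) + (1 - a) := by
      field_simp
      ring
    rw [Finset.sum_range_succ', incrementProb, hf, add_pow]
    simp only [negBinom, zero_mul, add_zero, mul_assoc]
    congr 1
    rw [Finset.mul_sum]
    refine Finset.sum_congr rfl fun n _ => ?_
    rw [mul_pow]
    ring

lemma lintegral_expMeasure_compoundProb (ha0 : 0 < a) (ha1 : a < 1) (hlam : 0 < lam)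
    (hmu : 0 < mu) (k : ℕ) :
    ∫⁻ x, ENNReal.ofReal (compoundProb a (lam * x) k) ∂(expMeasure mu) =
      ENNReal.ofReal (incrementProb a lam mu k) := by
  have hr : 0 < mu + lam := by positivity
  have hm : Measurable fun x => ENNReal.ofReal (compoundProb a (lam * x) k) :=
    ((continuous_compoundProb a k).measurable.comp
      (measurable_const.mul measurable_id)).ennreal_ofReal
  have hterm : ∀ s, compoundProb a (lam * s) k * (mu * Real.exp (-(mu * s))) =
      ∑ n ∈ Finset.range (k + 1), mu * (lam / (mu + lam)) ^ n * negBinom a n k / n.factorial *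
        (((mu + lam) * s) ^ n * Real.exp (-((mu + lam) * s))) := by
    intro s
    rw [compoundProb, Finset.sum_mul]
    refine Finset.sum_congr rfl fun n _ => ?_
    have e1 : Real.exp (-((mu + lam) * s)) = Real.exp (-(lam * s)) * Real.exp (-(mu * s)) := by
      rw [← Real.exp_add]; ring_nf
    have e2 : (lam * s) ^ n = (lam / (mu + lam)) ^ n * ((mu + lam) * s) ^ n := by
      rw [← mul_pow]; congr 1; field_simp
    rw [e1, e2]
    ring
  have hint : ∀ n ∈ Finset.range (k + 1), IntegrableOn (fun s =>
      mu * (lam / (mu + lam)) ^ n * negBinom a n k / n.factorial *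
        (((mu + lam) * s) ^ n * Real.exp (-((mu + lam) * s)))) (Set.Ioi 0) :=
    fun n _ => (integrableOn_poisson_term hr le_rfl n).const_mul _
  have hmul : ∀ s ∈ Set.Ioi (0 : ℝ), ENNReal.ofReal (compoundProb a (lam * s) k) *
      ENNReal.ofReal (mu * Real.exp (-(mu * s))) =
      ENNReal.ofReal (compoundProb a (lam * s) k * (mu * Real.exp (-(mu * s)))) := fun s hs =>
    (ENNReal.ofReal_mul
      (compoundProb_nonneg ha0 ha1 (mul_nonneg hlam.le (le_of_lt hs)) k)).symm
  rw [lintegral_expMeasure mu hm, setLIntegral_congr_fun measurableSet_Ioi hmul,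
    ← ofReal_integral_eq_lintegral_ofReal]
  · congr 1
    simp_rw [hterm]
    rw [integral_finsetSum _ hint, ← sum_negBinom_mul_pow hlam hmu]
    refine Finset.sum_congr rfl fun n _ => ?_
    rw [integral_const_mul, integral_poisson_term hr, mul_zero, regGamma_succ_zero]
    have : (n.factorial : ℝ) ≠ 0 := by positivity
    field_simp
    ring
  · simp_rw [hterm]
    exact integrable_finsetSum _ hint
  · refine (ae_restrict_mem measurableSet_Ioi).mono fun s hs => ?_
    exact mul_nonneg (compoundProb_nonneg ha0 ha1 (mul_nonneg hlam.le (le_of_lt hs)) k)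
      (by positivity)

end Integrals

/-! ### From occupation and increment weights to the closed form. -/

section Algebra

variable {a lam mu : ℝ}

lemma coeffG_eq (ha1 : a < 1) (lam mu t : ℝ) (j : ℕ) :
    coeffG a lam mu t j = ∑ k ∈ Finset.range (j + 1), (j.choose k : ℝ) * a ^ k * (1 - a) ^ (j - k) *
      (regGamma k (lam * t) + mu / lam * regGamma (k + 1) (lam * t)) := by
  have hb : 1 - a ≠ 0 := by linarith
  rw [coeffG, Finset.mul_sum]
  refine Finset.sum_congr rfl fun k hk => ?_
  have hk' : k ≤ j := by simpa [Nat.lt_succ_iff] using hk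
  rw [pow_sub₀ _ hb hk', div_pow]
  field_simp

lemma coeffH_eq (ha1 : a < 1) (lam mu t : ℝ) (j : ℕ) :
    coeffH a lam mu t j = ∑ k ∈ Finset.range (j + 1), (j.choose k : ℝ) * a ^ k * (1 - a) ^ (j - k) *
      ((1 - a) * (regGamma k (lam * t) + mu / lam * regGamma (k + 1) (lam * t)) +
        a * regGamma (k + 1) (lam * t)) := by
  have hb : 1 - a ≠ 0 := by linarith
  rw [coeffH, Finset.mul_sum]
  refine Finset.sum_congr rfl fun k hk => ?_
  have hk' : k ≤ j := by simpa [Nat.lt_succ_iff] using hk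
  rw [pow_sub₀ _ hb hk', div_pow]
  field_simp
  ring

lemma coeffG_zero (hlam : 0 < lam) (mu t : ℝ) :
    coeffG a lam mu t 0 = (mu + lam) / lam - occupation a lam mu t 0 := by
  simp [coeffG, occupation, negBinom, regGamma]
  field_simp
  ring

lemma sum_choose_mul_pow (a : ℝ) (j : ℕ) :
    ∑ k ∈ Finset.range (j + 1), (j.choose k : ℝ) * a ^ k * (1 - a) ^ (j - k) = 1 := by
  have := add_pow a (1 - a) j
  rw [add_sub_cancel, one_pow] at this
  refine Eq.trans (Finset.sum_congr rfl fun k _ => ?_) this.symm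
  ring

/-- Pascal's rule gives `b Q k + a Q (k + 1)` under the binomial weights. The part `a * regGamma (k
+ 1)` of the second term completes `H_j`; the part with `regGamma (k + 2)` is the complement of the
occupation, since the weights add up to `1`. -/
lemma coeffG_succ (ha1 : a < 1) (lam mu t : ℝ) (j : ℕ) :
    coeffG a lam mu t (j + 1) =
      coeffH a lam mu t j + (a * mu / lam - occupation a lam mu t (j + 1)) := by
  let Q : ℕ → ℝ := fun k => regGamma k (lam * t) + mu / lam * regGamma (k + 1) (lam * t)
  have hocc : a * mu / lam - occupation a lam mu t (j + 1) =
      ∑ k ∈ Finset.range (j + 1), (j.choose k : ℝ) * a ^ k * (1 - a) ^ (j - k) *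
        (a * (mu / lam * regGamma (k + 2) (lam * t))) := by
    have h1 : a * mu / lam = ∑ k ∈ Finset.range (j + 1),
        (j.choose k : ℝ) * a ^ k * (1 - a) ^ (j - k) * (a * mu / lam) := by
      rw [← Finset.sum_mul, sum_choose_mul_pow, one_mul]
    rw [occupation, Finset.sum_range_succ', h1]
    simp only [negBinom, zero_mul, add_zero]
    rw [Finset.mul_sum, ← Finset.sum_sub_distrib]
    exact Finset.sum_congr rfl fun k _ => by ring
  have hpascal : ∑ k ∈ Finset.range (j + 2),
      ((j + 1).choose k : ℝ) * a ^ k * (1 - a) ^ (j + 1 - k) * Q k =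
      (1 - a) * ∑ k ∈ Finset.range (j + 1), (j.choose k : ℝ) * a ^ k * (1 - a) ^ (j - k) * Q k +
      a * ∑ k ∈ Finset.range (j + 1),
        (j.choose k : ℝ) * a ^ k * (1 - a) ^ (j - k) * Q (k + 1) := by
    have hshift : (1 - a) * ∑ k ∈ Finset.range (j + 1),
        (j.choose k : ℝ) * a ^ k * (1 - a) ^ (j - k) * Q k =
        ∑ k ∈ Finset.range (j + 2), (j.choose k : ℝ) * a ^ k * (1 - a) ^ (j + 1 - k) * Q k := by
      rw [Finset.sum_range_succ _ (j + 1), Nat.choose_succ_self, Finset.mul_sum]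
      simp only [Nat.cast_zero, zero_mul, add_zero]
      refine Finset.sum_congr rfl fun k hk => ?_
      have hk' : k ≤ j := by simpa [Nat.lt_succ_iff] using hk
      rw [Nat.succ_sub hk', pow_succ]
      ring
    rw [hshift, Finset.sum_range_succ', Finset.sum_range_succ' _ (j + 1), Finset.mul_sum,
      add_right_comm, ← Finset.sum_add_distrib]
    congr 1
    · refine Finset.sum_congr rfl fun k _ => ?_
      rw [Nat.choose_succ_succ, Nat.add_sub_add_right]
      push_cast
      ring
    · simp
  rw [coeffG_eq ha1, coeffH_eq ha1, hocc, ← Finset.sum_add_distrib]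
  refine Eq.trans hpascal ?_
  rw [Finset.mul_sum, Finset.mul_sum, ← Finset.sum_add_distrib]
  refine Finset.sum_congr rfl fun k _ => ?_
  simp only [Q]
  ring

/-- Partial sums of the generating function of `incrementProb`. -/
lemma sum_incrementProb_mul_pow (hlam : 0 < lam) (hmu : 0 < mu) (v : ℂ) (n : ℕ) :
    ∑ k ∈ Finset.range n, (incrementProb a lam mu k : ℂ) * v ^ k =
      (mu : ℂ) / (mu + lam) * (∑ i ∈ Finset.range n, fracF a lam mu v ^ i -
        ((1 - a : ℝ) : ℂ) * v * ∑ i ∈ Finset.range (n - 1), fracF a lam mu v ^ i) := by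
  have hr : (mu : ℂ) + lam ≠ 0 := by
    have : mu + lam ≠ 0 := by positivity
    exact_mod_cast this
  rcases n with _ | n
  · simp
  induction n with
  | zero => simp [incrementProb]
  | succ n ih =>
    rw [Finset.sum_range_succ, ih, Finset.sum_range_succ _ (n + 1)]
    simp only [Nat.add_sub_cancel]
    rw [Finset.sum_range_succ _ n, incrementProb]
    have hF : fracF a lam mu v = ((1 - a) * mu + lam) / (mu + lam) * v := by
      simp [fracF]
    have hab : (a : ℂ) * lam / (mu + lam) = ((1 - a) * mu + lam) / (mu + lam) - (1 - a) := by
      field_simp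
      ring
    push_cast
    rw [hab, hF]
    generalize ((1 - (a : ℂ)) * mu + lam) / (mu + lam) = f
    ring

/-- The kernel `T` is left free because the recurrence for `e` is needed twice: with `T = 1` for the
coefficient of `γ(v, 0)`, and with the partial sums of the increment weights. -/
lemma sum_convolution (c F v : ℂ) (G H e T : ℕ → ℂ) (h0 : e 0 = c - G 0)
    (hs : ∀ j, e (j + 1) =
      c * (v ^ (j + 1) - F * v ^ j) - v ^ (j + 1) * G (j + 1) + v ^ (j + 1) * H j) (M : ℕ) :
    ∑ i ∈ Finset.range (M + 1), e i * T (M + 1 - i) =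
      c * (∑ i ∈ Finset.range (M + 1), v ^ i * T (M + 1 - i) -
        F * ∑ i ∈ Finset.range M, v ^ i * T (M - i)) -
      ∑ i ∈ Finset.range (M + 1), v ^ i * G i * T (M + 1 - i) +
      ∑ i ∈ Finset.range M, v ^ (i + 1) * H i * T (M - i) := by
  rw [Finset.sum_range_succ', Finset.sum_range_succ' (fun i => v ^ i * T (M + 1 - i)),
    Finset.sum_range_succ' (fun i => v ^ i * G i * T (M + 1 - i))]
  simp only [hs, h0, Nat.add_sub_add_right, pow_zero, one_mul, Nat.sub_zero]
  have hsum : ∑ i ∈ Finset.range M, (c * (v ^ (i + 1) - F * v ^ i) - v ^ (i + 1) * G (i + 1) +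
      v ^ (i + 1) * H i) * T (M - i) =
      c * (∑ i ∈ Finset.range M, v ^ (i + 1) * T (M - i) -
        F * ∑ i ∈ Finset.range M, v ^ i * T (M - i)) -
      ∑ i ∈ Finset.range M, v ^ (i + 1) * G (i + 1) * T (M - i) +
      ∑ i ∈ Finset.range M, v ^ (i + 1) * H i * T (M - i) := by
    simp only [Finset.mul_sum, ← Finset.sum_sub_distrib, ← Finset.sum_add_distrib]
    exact Finset.sum_congr rfl fun i _ => by ring
  rw [hsum]
  ring

/-- The last term on the left contains `S 0`; its vanishing makes truncated subtraction harmless and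
produces the shorter ranges of the closed form. -/
lemma sum_mul_pred (x S : ℕ → ℂ) (hS : S 0 = 0) (n : ℕ) :
    ∑ i ∈ Finset.range n, x i * S (n - i - 1) =
      ∑ i ∈ Finset.range (n - 1), x i * S (n - 1 - i) := by
  rcases n with _ | n
  · simp
  · rw [Finset.sum_range_succ, Nat.add_sub_cancel]
    simp only [Nat.add_sub_cancel_left, Nat.sub_self, hS, mul_zero, add_zero]
    exact Finset.sum_congr rfl fun i _ => by rw [Nat.sub_right_comm, Nat.add_sub_cancel]

/-- The closed form as a sum over the last observed value before the crossing. -/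
lemma closedForm_eq_sum (ha1 : a < 1) (hlam : 0 < lam) (hmu : 0 < mu) (t : ℝ) (g v : ℂ) (M : ℕ) :
    closedForm a lam mu t g v (M + 1) =
      ∑ i ∈ Finset.range (M + 1), v ^ i * (occupation a lam mu t i : ℂ) *
        (g - ∑ k ∈ Finset.range (M + 1 - i), (incrementProb a lam mu k : ℂ) * v ^ k) := by
  have hr : (mu : ℂ) + lam ≠ 0 := by
    have : mu + lam ≠ 0 := by positivity
    exact_mod_cast this
  have hl : (lam : ℂ) ≠ 0 := by exact_mod_cast hlam.ne'
  let b : ℂ := ((1 - a : ℝ) : ℂ)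
  let F := fracF a lam mu v
  let G : ℕ → ℂ := fun j => (coeffG a lam mu t j : ℂ)
  let H : ℕ → ℂ := fun j => (coeffH a lam mu t j : ℂ)
  let S : ℕ → ℂ := fun n => ∑ i ∈ Finset.range n, F ^ i
  let e : ℕ → ℂ := fun i => v ^ i * (occupation a lam mu t i : ℂ)
  have hS : S 0 = 0 := by simp [S]
  have h0 : e 0 = ((mu : ℂ) + lam) / lam - G 0 := by
    simp only [e, G, coeffG_zero hlam]
    push_cast
    ring
  have hs : ∀ j, e (j + 1) = ((mu : ℂ) + lam) / lam * (v ^ (j + 1) - F * v ^ j) -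
      v ^ (j + 1) * G (j + 1) + v ^ (j + 1) * H j := by
    intro j
    -- This turns the constant `a * mu / lam` of `coeffG_succ` into the shape `c * (v - F)` that
    -- `sum_convolution` expects.
    have hF : ((mu : ℂ) + lam) / lam * (v - F) = a * mu / lam * v := by
      simp only [F, fracF]
      push_cast
      field_simp
      ring
    have hF' : ((mu : ℂ) + lam) / lam * (v ^ (j + 1) - F * v ^ j) = a * mu / lam * v * v ^ j := by
      rw [← hF]
      ring
    rw [hF']
    simp only [e, G, H, coeffG_succ ha1]
    push_cast
    ring
  have hconst := sum_convolution (((mu : ℂ) + lam) / lam) F v G H e (fun _ => 1) h0 hs M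
  have hconv := sum_convolution (((mu : ℂ) + lam) / lam) F v G H e
    (fun n => S n - b * v * S (n - 1)) h0 hs M
  have hsplit : ∀ (x : ℕ → ℂ) (n : ℕ),
      ∑ i ∈ Finset.range n, x i * (S (n - i) - b * v * S (n - i - 1)) =
      ∑ i ∈ Finset.range n, x i * S (n - i) -
        b * v * ∑ i ∈ Finset.range (n - 1), x i * S (n - 1 - i) := by
    intro x n
    rw [← sum_mul_pred x S hS n, Finset.mul_sum, ← Finset.sum_sub_distrib]
    exact Finset.sum_congr rfl fun i _ => by ring
  rw [hsplit (fun i => v ^ i) (M + 1), hsplit (fun i => v ^ i) M,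
    hsplit (fun i => v ^ i * G i) (M + 1), hsplit (fun i => v ^ (i + 1) * H i) M] at hconv
  simp only [mul_one, Nat.add_sub_cancel] at hconst hconv
  have hrhs : ∑ i ∈ Finset.range (M + 1), v ^ i * (occupation a lam mu t i : ℂ) *
        (g - ∑ k ∈ Finset.range (M + 1 - i), (incrementProb a lam mu k : ℂ) * v ^ k) =
      g * ∑ i ∈ Finset.range (M + 1), e i - (mu : ℂ) / (mu + lam) *
        ∑ i ∈ Finset.range (M + 1), e i * (S (M + 1 - i) - b * v * S (M + 1 - i - 1)) := by
    rw [Finset.mul_sum, Finset.mul_sum, ← Finset.sum_sub_distrib]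
    refine Finset.sum_congr rfl fun i _ => ?_
    rw [sum_incrementProb_mul_pow hlam hmu]
    simp only [e, S, F, b]
    ring
  have hGH : ∑ j ∈ Finset.range M, v ^ (j + 1) * (b * G j + H j) * S (M - j) =
      b * v * ∑ j ∈ Finset.range M, v ^ j * G j * S (M - j) +
        ∑ j ∈ Finset.range M, v ^ (j + 1) * H j * S (M - j) := by
    rw [Finset.mul_sum, ← Finset.sum_add_distrib]
    exact Finset.sum_congr rfl fun i _ => by ring
  have hH : b * ∑ j ∈ Finset.range (M - 1), v ^ (j + 2) * H j * S (M - 1 - j) =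
      b * v * ∑ j ∈ Finset.range (M - 1), v ^ (j + 1) * H j * S (M - 1 - j) := by
    rw [Finset.mul_sum, Finset.mul_sum]
    exact Finset.sum_congr rfl fun i _ => by ring
  rw [hrhs, hconst, hconv]
  have hclosed : closedForm a lam mu t g v (M + 1) =
      g * (((mu : ℂ) + lam) / lam) * (v ^ M + (1 - F) * ∑ j ∈ Finset.range M, v ^ j)
      - g * (v ^ M * G M + ∑ j ∈ Finset.range M, (v ^ j * G j - v ^ (j + 1) * H j))
      - (mu : ℂ) / lam * (∑ j ∈ Finset.range (M + 1), v ^ j * S (M + 1 - j)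
          - (F + b * v) * ∑ j ∈ Finset.range M, v ^ j * S (M - j)
          + b * v * F * ∑ j ∈ Finset.range (M - 1), v ^ j * S (M - 1 - j))
      + (mu : ℂ) / (mu + lam) * (∑ j ∈ Finset.range (M + 1), v ^ j * G j * S (M + 1 - j)
          - ∑ j ∈ Finset.range M, v ^ (j + 1) * (b * G j + H j) * S (M - j)
          + b * ∑ j ∈ Finset.range (M - 1), v ^ (j + 2) * H j * S (M - 1 - j)) := rfl
  have hml : (mu : ℂ) / lam = (mu : ℂ) / (mu + lam) * ((mu + lam) / lam) := by
    field_simp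
  rw [hclosed, hGH, hH, hml, Finset.sum_sub_distrib, Finset.sum_range_succ (fun i => v ^ i),
    Finset.sum_range_succ (fun i => v ^ i * G i)]
  ring

end Algebra

/-! ### Decomposition of the exit variable. -/

section Exit

variable {Ω : Type*} [MeasurableSpace Ω] {P : Measure Ω}
  {a mu : ℝ} {lam : ℝ≥0} {N : ℝ≥0 → Ω → ℕ} {mark : ℕ → Ω → ℕ} {Δ : ℕ → Ω → ℝ≥0}

lemma IsModel.ae_obsTime_zero (h : IsModel N mark Δ a lam mu P) :
    ∀ᵐ ω ∂P, obsTime Δ 0 ω = 0 := by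
  filter_upwards [h.obs_zero] with ω hω
  simp [obsTime, hω]

lemma IsModel.ae_obsValue_zero (h : IsModel N mark Δ a lam mu P) :
    ∀ᵐ ω ∂P, obsValue (markedProcess N mark) Δ 0 ω = 0 := by
  filter_upwards [h.ae_obsTime_zero] with ω hω
  simp [obsValue, hω, markedProcess, h.poisson.zero]

lemma IsModel.increment_law [IsProbabilityMeasure P] (h : IsModel N mark Δ a lam mu P)
    (ha0 : 0 < a) (ha1 : a < 1) (hlam : 0 < lam) (hmu : 0 < mu) (k : ℕ) :
    P {ω | obsValue (markedProcess N mark) Δ 1 ω - obsValue (markedProcess N mark) Δ 0 ω = k} =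
      ENNReal.ofReal (incrementProb a lam mu k) := by
  have hc := h.consecutive_obsValue_law ha0 ha1 (T := Set.univ) .univ 0 0 k
  have h1 : ∫⁻ ω, (Set.univ : Set ℝ≥0).indicator
      (fun s => ENNReal.ofReal (compoundProb a (lam * s) 0)) (obsTime Δ 0 ω) ∂P = 1 := by
    have : ∀ᵐ ω ∂P, (Set.univ : Set ℝ≥0).indicator
        (fun s => ENNReal.ofReal (compoundProb a (lam * s) 0)) (obsTime Δ 0 ω) = 1 := by
      filter_upwards [h.ae_obsTime_zero] with ω hω
      simp [hω, compoundProb_zero_zero]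
    rw [lintegral_congr_ae this]
    simp
  rw [h1, one_mul, lintegral_expMeasure_compoundProb ha0 ha1 (by exact_mod_cast hlam) hmu] at hc
  rw [← hc]
  refine measure_congr ?_
  filter_upwards [h.ae_obsValue_zero] with ω hω
  refine propext ?_
  change (_ - _ = k) ↔ (_ ∧ _ = 0 ∧ _ = 0 + k)
  simp [hω]

lemma IsModel.hasSum_jointTransform [IsProbabilityMeasure P] (h : IsModel N mark Δ a lam mu P)
    (ha0 : 0 < a) (ha1 : a < 1) (hlam : 0 < lam) (hmu : 0 < mu) {v : ℂ} (hv : ‖v‖ ≤ 1) :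
    HasSum (fun k => (incrementProb a lam mu k : ℂ) * v ^ k)
      (jointTransform (markedProcess N mark) Δ P v 0) := by
  let X : Ω → ℕ := fun ω =>
    obsValue (markedProcess N mark) Δ 1 ω - obsValue (markedProcess N mark) Δ 0 ω
  have hX : Measurable X := (h.measurable_obsValue 1).sub (h.measurable_obsValue 0)
  have hfm : Measurable fun ω => v ^ X ω :=
    (measurable_from_nat (f := fun n => v ^ n)).comp hX
  have hint : Integrable (fun ω => v ^ X ω) P := by
    refine Integrable.of_bound hfm.aestronglyMeasurable 1 (.of_forall fun ω => ?_)
    rw [norm_pow]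
    exact pow_le_one₀ (norm_nonneg _) hv
  have hU : ⋃ k, X ⁻¹' {k} = Set.univ := by
    ext ω; simp
  have hsum := hasSum_integral_iUnion (μ := P) (f := fun ω => v ^ X ω) (s := fun k => X ⁻¹' {k})
    (fun k => hX (measurableSet_singleton k))
    (fun i j hij => Set.disjoint_left.2 fun ω h1 h2 => hij (h1.symm.trans h2))
    hint.integrableOn
  rw [hU, setIntegral_univ] at hsum
  have hγ : jointTransform (markedProcess N mark) Δ P v 0 = ∫ ω, v ^ X ω ∂P := by
    simp [jointTransform, X]
  rw [hγ]
  have hfun : ∀ k, ∫ ω in X ⁻¹' {k}, v ^ X ω ∂P = (incrementProb a lam mu k : ℂ) * v ^ k := by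
    intro k
    have hlam' : (0 : ℝ) < lam := by exact_mod_cast hlam
    have hlaw : P (X ⁻¹' {k}) = ENNReal.ofReal (incrementProb a lam mu k) :=
      h.increment_law ha0 ha1 hlam hmu k
    rw [setIntegral_congr_fun (g := fun _ => v ^ k) (hX (measurableSet_singleton k))
      (fun ω hω => congrArg (v ^ ·) hω), setIntegral_const, measureReal_def, hlaw,
      ENNReal.toReal_ofReal (incrementProb_nonneg ha0 ha1 hlam' hmu k), Complex.real_smul]
  simp only [hfun] at hsum
  exact hsum

/-- The event that the observed value is `i` at some observation after time `t`, and `i + k` at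
the next observation. -/
def jumpEvent (A : ℝ≥0 → Ω → ℕ) (Δ : ℕ → Ω → ℝ≥0) (t : ℝ≥0) (i k : ℕ) : Set Ω :=
  ⋃ m, {ω | obsTime Δ m ω ∈ Set.Ioi t ∧ obsValue A Δ m ω = i ∧ obsValue A Δ (m + 1) ω = i + k}

lemma IsModel.measurableSet_jump (h : IsModel N mark Δ a lam mu P) (t : ℝ≥0) (m i k : ℕ) :
    MeasurableSet {ω | obsTime Δ m ω ∈ Set.Ioi t ∧ obsValue (markedProcess N mark) Δ m ω = i ∧
      obsValue (markedProcess N mark) Δ (m + 1) ω = i + k} :=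
  (h.measurable_obsTime m measurableSet_Ioi).inter
    ((h.measurable_obsValue m (measurableSet_singleton i)).inter
      (h.measurable_obsValue (m + 1) (measurableSet_singleton (i + k))))

lemma IsModel.measurableSet_jumpEvent (h : IsModel N mark Δ a lam mu P) (t : ℝ≥0) (i k : ℕ) :
    MeasurableSet (jumpEvent (markedProcess N mark) Δ t i k) :=
  .iUnion fun m => h.measurableSet_jump t m i k

lemma IsModel.tsum_occupation [IsProbabilityMeasure P] (h : IsModel N mark Δ a lam mu P)
    (ha0 : 0 < a) (ha1 : a < 1) (hlam : 0 < lam) (hmu : 0 < mu) (t : ℝ≥0) (i : ℕ) :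
    ∑' m, ∫⁻ ω, (Set.Ioi t).indicator (fun s : ℝ≥0 => ENNReal.ofReal (compoundProb a (lam * s) i))
      (obsTime Δ m ω) ∂P = ENNReal.ofReal (occupation a lam mu t i) := by
  let f : ℝ → ℝ≥0∞ :=
    (Set.Ioi (t : ℝ)).indicator fun s => ENNReal.ofReal (compoundProb a (lam * s) i)
  have hf : Measurable f :=
    ((continuous_compoundProb a i).measurable.comp
      (measurable_const.mul measurable_id)).ennreal_ofReal.indicator measurableSet_Ioi
  have hcoe : ∀ s : ℝ≥0, (Set.Ioi t).indicator
      (fun s : ℝ≥0 => ENNReal.ofReal (compoundProb a (lam * s) i)) s = f s := by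
    intro s
    simp [f, Set.indicator_apply]
  simp_rw [hcoe]
  -- The epoch `τ_0 = 0` never exceeds `t`, so only the epochs counted by the renewal measure
  -- contribute.
  have h0 : ∫⁻ ω, f (obsTime Δ 0 ω) ∂P = 0 := by
    have hz : ∀ᵐ ω ∂P, f (obsTime Δ 0 ω) = 0 := by
      filter_upwards [h.ae_obsTime_zero] with ω hω
      simp [f, hω]
    rw [lintegral_congr_ae hz, lintegral_zero]
  rw [tsum_eq_zero_add' ENNReal.summable, h0, zero_add, h.tsum_lintegral_obsTime hmu hf,
    ← lintegral_compoundProb ha0 ha1 (by exact_mod_cast hlam) hmu t.coe_nonneg i,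
    setLIntegral_indicator measurableSet_Ioi,
    Set.inter_eq_left.2 (Set.Ioi_subset_Ioi t.coe_nonneg)]

/-- For `k > 0` a monotone path leaves the level `i` only once, so the events for different `m` are
disjoint. For `k = 0` they can overlap. -/
lemma IsModel.measure_jumpEvent [IsProbabilityMeasure P] (h : IsModel N mark Δ a lam mu P)
    (ha0 : 0 < a) (ha1 : a < 1) (hlam : 0 < lam) (hmu : 0 < mu) (t : ℝ≥0) (i : ℕ) {k : ℕ}
    (hk : 0 < k) :
    P (jumpEvent (markedProcess N mark) Δ t i k) =
      ENNReal.ofReal (occupation a lam mu t i * incrementProb a lam mu k) := by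
  have hlam' : (0 : ℝ) < lam := by exact_mod_cast hlam
  have hlt : ∀ {m m'} {ω : Ω}, m < m' → obsValue (markedProcess N mark) Δ (m + 1) ω = i + k →
      obsValue (markedProcess N mark) Δ m' ω = i → False := by
    intro m m' ω hmm h1 h2
    have := h.monotone_obsValue ω (show m + 1 ≤ m' from hmm)
    simp only at this
    omega
  rw [jumpEvent, measure_iUnion _ fun m => h.measurableSet_jump t m i k]
  · simp_rw [h.consecutive_obsValue_law ha0 ha1 measurableSet_Ioi]
    rw [ENNReal.tsum_mul_right, h.tsum_occupation ha0 ha1 hlam hmu,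
      lintegral_expMeasure_compoundProb ha0 ha1 hlam' hmu,
      ENNReal.ofReal_mul (occupation_nonneg ha0 ha1 hlam' hmu t.coe_nonneg i)]
  · intro m m' hne
    refine Set.disjoint_left.2 ?_
    rintro ω ⟨-, h1, h2⟩ ⟨-, h3, h4⟩
    rcases lt_or_gt_of_ne hne with hmm | hmm
    · exact hlt hmm h2 h3
    · exact hlt hmm h4 h1

/-- The expected number of visits to each level is finite (the occupation with `t = 0`), so by
Borel–Cantelli the finitely many levels up to `M` are all eventually left. -/
lemma IsModel.ae_exists_lt_obsValue [IsProbabilityMeasure P] (h : IsModel N mark Δ a lam mu P)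
    (ha0 : 0 < a) (ha1 : a < 1) (hlam : 0 < lam) (hmu : 0 < mu) (M : ℕ) :
    ∀ᵐ ω ∂P, ∃ n, M < obsValue (markedProcess N mark) Δ n ω := by
  have hfin : ∀ i, ∀ᵐ ω ∂P, ∀ᶠ m in Filter.atTop,
      obsValue (markedProcess N mark) Δ (m + 1) ω ≠ i := by
    intro i
    have hf : Measurable fun s : ℝ => ENNReal.ofReal (compoundProb a (lam * s) i) :=
      ((continuous_compoundProb a i).measurable.comp
        (measurable_const.mul measurable_id)).ennreal_ofReal
    refine ae_eventually_notMem (s := fun m => {ω | obsValue (markedProcess N mark) Δ (m + 1) ω = i})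
      ?_
    simp_rw [h.obsValue_law ha0 ha1]
    rw [h.tsum_lintegral_obsTime hmu hf,
      lintegral_compoundProb ha0 ha1 (by exact_mod_cast hlam) hmu le_rfl]
    exact ENNReal.ofReal_ne_top
  filter_upwards [ae_all_iff.2 hfin] with ω hω
  by_contra hcon
  push Not at hcon
  obtain ⟨m, hm⟩ := ((Filter.eventually_all_finset (Finset.range (M + 1))).2
    fun i _ => hω i).exists
  exact hm _ (Finset.mem_range_succ_iff.2 (hcon (m + 1))) rfl

/-- By monotonicity the jump across `M` is the first crossing, so `ν = m + 1`. The values at `ν` and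
`ν - 1` recover `(i, k)`, which later gives disjointness of the jump events. -/
lemma IsModel.exitVariable_eq_of_mem (h : IsModel N mark Δ a lam mu P) {M i k : ℕ} (hi : i ≤ M)
    (hk : M < i + k) (v : ℂ) (t : ℝ≥0) {ω : Ω}
    (hω : ω ∈ jumpEvent (markedProcess N mark) Δ t i k) :
    obsValue (markedProcess N mark) Δ (exitIndex (markedProcess N mark) Δ M ω) ω = i + k ∧
      obsValue (markedProcess N mark) Δ (exitIndex (markedProcess N mark) Δ M ω - 1) ω = i ∧
      exitVariable (markedProcess N mark) Δ M v t ω = v ^ (i + k) := by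
  obtain ⟨m, ht, h1, h2⟩ := Set.mem_iUnion.1 hω
  have hexit : exitIndex (markedProcess N mark) Δ M ω = m + 1 := by
    refine le_antisymm (Nat.sInf_le (by change M < _; omega)) (le_csInf ⟨m + 1, ?_⟩ ?_)
    · change M < _; omega
    · intro n hn
      by_contra hlt
      have := h.monotone_obsValue ω (show n ≤ m by omega)
      have hn' : M < obsValue (markedProcess N mark) Δ n ω := hn
      simp only at this
      omega
  refine ⟨by rw [hexit]; exact h2, by rw [hexit]; exact h1, ?_⟩
  rw [exitVariable, Set.indicator_of_mem]
  · rw [hexit, h2]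
  · change t < prevObsTime Δ (exitIndex (markedProcess N mark) Δ M ω) ω
    rw [hexit]
    exact ht

lemma IsModel.ae_exitVariable_eq_zero [IsProbabilityMeasure P] (h : IsModel N mark Δ a lam mu P)
    (ha0 : 0 < a) (ha1 : a < 1) (hlam : 0 < lam) (hmu : 0 < mu) (M : ℕ) (v : ℂ) (t : ℝ≥0) :
    ∀ᵐ ω ∂P, (∀ i k, i ≤ M → M < i + k → ω ∉ jumpEvent (markedProcess N mark) Δ t i k) →
      exitVariable (markedProcess N mark) Δ M v t ω = 0 := by
  filter_upwards [h.ae_exists_lt_obsValue ha0 ha1 hlam hmu M, h.ae_obsValue_zero] with ω hex h0 hω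
  refine Set.indicator_of_notMem (fun ht => ?_) _
  -- Almost sure crossing excludes the default `sInf ∅ = 0`; `A_0 = 0` then rules out exit at index
  -- `0`.
  have hmem : M < obsValue (markedProcess N mark) Δ (exitIndex (markedProcess N mark) Δ M ω) ω :=
    Nat.sInf_mem hex
  have ht' : t < prevObsTime Δ (exitIndex (markedProcess N mark) Δ M ω) ω := ht
  obtain ⟨m, hm⟩ : ∃ m, exitIndex (markedProcess N mark) Δ M ω = m + 1 := by
    refine Nat.exists_eq_succ_of_ne_zero fun hz => ?_
    rw [hz, h0] at hmem
    omega
  have hle : obsValue (markedProcess N mark) Δ m ω ≤ M := by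
    have := Nat.notMem_of_lt_sInf
      (show m < sInf {n | M < obsValue (markedProcess N mark) Δ n ω} from
        lt_of_lt_of_eq (Nat.lt_succ_self m) hm.symm)
    exact not_lt.1 this
  rw [hm] at hmem ht'
  have hadd : obsValue (markedProcess N mark) Δ (m + 1) ω =
      obsValue (markedProcess N mark) Δ m ω + (obsValue (markedProcess N mark) Δ (m + 1) ω -
        obsValue (markedProcess N mark) Δ m ω) := by omega
  exact hω _ _ hle (by omega) (Set.mem_iUnion.2 ⟨m, ht', rfl, hadd⟩)

/-- The expectation of the exit variable, expanded over the values before and at the exit. -/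
lemma IsModel.integral_exitVariable [IsProbabilityMeasure P] (h : IsModel N mark Δ a lam mu P)
    (ha0 : 0 < a) (ha1 : a < 1) (hlam : 0 < lam) (hmu : 0 < mu) (M : ℕ) {v : ℂ} (hv : ‖v‖ ≤ 1)
    (t : ℝ≥0) :
    Integrable (exitVariable (markedProcess N mark) Δ M v t) P ∧
    HasSum (fun p : ℕ × ℕ => if p.1 ≤ M ∧ M < p.1 + p.2 then
        (occupation a lam mu t p.1 : ℂ) * incrementProb a lam mu p.2 * v ^ (p.1 + p.2) else 0)
      (∫ ω, exitVariable (markedProcess N mark) Δ M v t ω ∂P) := by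
  classical
  let X := exitVariable (markedProcess N mark) Δ M v t
  let s : ℕ × ℕ → Set Ω := fun p => if p.1 ≤ M ∧ M < p.1 + p.2 then
    jumpEvent (markedProcess N mark) Δ t p.1 p.2 else ∅
  have hs : ∀ p, MeasurableSet (s p) := by
    intro p
    by_cases hp : p.1 ≤ M ∧ M < p.1 + p.2
    · simp only [s, if_pos hp]
      exact h.measurableSet_jumpEvent t _ _
    · simp only [s, if_neg hp]
      exact .empty
  have hmem : ∀ p ω, ω ∈ s p → (p.1 ≤ M ∧ M < p.1 + p.2) ∧
      ω ∈ jumpEvent (markedProcess N mark) Δ t p.1 p.2 := by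
    intro p ω hω
    by_cases hp : p.1 ≤ M ∧ M < p.1 + p.2
    · simp only [s, if_pos hp] at hω
      exact ⟨hp, hω⟩
    · simp [s, if_neg hp] at hω
  have hX : ∀ p, ∀ ω ∈ s p, X ω = v ^ (p.1 + p.2) := by
    intro p ω hω
    obtain ⟨hp, hj⟩ := hmem p ω hω
    exact (h.exitVariable_eq_of_mem hp.1 hp.2 v t hj).2.2
  have hdisj : Pairwise (Function.onFun Disjoint s) := by
    intro p q hne
    refine Set.disjoint_left.2 fun ω h1 h2 => hne ?_
    obtain ⟨hp, hj⟩ := hmem p ω h1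
    obtain ⟨hq, hj'⟩ := hmem q ω h2
    obtain ⟨e1, e2, -⟩ := h.exitVariable_eq_of_mem hp.1 hp.2 v t hj
    obtain ⟨e3, e4, -⟩ := h.exitVariable_eq_of_mem hq.1 hq.2 v t hj'
    exact Prod.ext (by omega) (by omega)
  have hzero : ∀ᵐ ω ∂P, ω ∉ ⋃ p, s p → X ω = 0 := by
    filter_upwards [h.ae_exitVariable_eq_zero ha0 ha1 hlam hmu M v t] with ω hω hn
    refine hω fun i k hi hk hj => hn (Set.mem_iUnion.2 ⟨(i, k), ?_⟩)
    simp only [s, if_pos (And.intro hi hk)]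
    exact hj
  -- Measurability of the exit index is not needed: `X` is constant on countably many measurable
  -- pieces and almost surely zero off them.
  have hmeas : AEStronglyMeasurable X P := by
    have hr : AEStronglyMeasurable X (P.restrict (⋃ p, s p)) := by
      refine aestronglyMeasurable_iUnion_iff.2 fun p => ?_
      refine (aestronglyMeasurable_const (b := v ^ (p.1 + p.2))).congr ?_
      filter_upwards [ae_restrict_mem (hs p)] with ω hω
      exact (hX p ω hω).symm
    refine ((aestronglyMeasurable_indicator_iff (MeasurableSet.iUnion hs)).2 hr).congr ?_
    filter_upwards [hzero] with ω hω
    by_cases hu : ω ∈ ⋃ p, s p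
    · rw [Set.indicator_of_mem hu]
    · rw [Set.indicator_of_notMem hu, hω hu]
  have hint : Integrable X P := by
    refine Integrable.of_bound hmeas 1 (.of_forall fun ω => ?_)
    refine (norm_indicator_le_norm_self _ _).trans ?_
    rw [norm_pow]
    exact pow_le_one₀ (norm_nonneg _) hv
  refine ⟨hint, ?_⟩
  have hsum := hasSum_integral_iUnion (μ := P) hs hdisj hint.integrableOn
  rw [setIntegral_eq_integral_of_ae_compl_eq_zero hzero] at hsum
  have hfun : ∀ p : ℕ × ℕ, ∫ ω in s p, X ω ∂P = if p.1 ≤ M ∧ M < p.1 + p.2 then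
      (occupation a lam mu t p.1 : ℂ) * incrementProb a lam mu p.2 * v ^ (p.1 + p.2) else 0 := by
    intro p
    rw [setIntegral_congr_fun (hs p) (hX p), setIntegral_const]
    by_cases hp : p.1 ≤ M ∧ M < p.1 + p.2
    · have hlam' : (0 : ℝ) < lam := by exact_mod_cast hlam
      simp only [s, if_pos hp]
      rw [measureReal_def, h.measure_jumpEvent ha0 ha1 hlam hmu t p.1 (by omega),
        ENNReal.toReal_ofReal (mul_nonneg (occupation_nonneg ha0 ha1 hlam' hmu t.coe_nonneg _)
          (incrementProb_nonneg ha0 ha1 hlam' hmu _)), Complex.real_smul]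
      push_cast
      rfl
    · simp [s, if_neg hp]
  simp only [hfun] at hsum
  exact hsum

end Exit

end DelayedPassage

/-! ### Summation over the jump and conclusion. -/

theorem mainTheorem8 {Ω : Type*} [MeasurableSpace Ω] (P : Measure Ω) [IsProbabilityMeasure P]
    (a : ℝ) (ha0 : 0 < a) (ha1 : a < 1) (lam : ℝ≥0) (hlam : 0 < lam) (mu : ℝ) (hmu : 0 < mu)
    (N : ℝ≥0 → Ω → ℕ) (mark : ℕ → Ω → ℕ) (Δ : ℕ → Ω → ℝ≥0)
    (hmodel : DelayedPassage.IsModel N mark Δ a lam mu P)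
    (A : ℝ≥0 → Ω → ℕ) (hA : A = DelayedPassage.markedProcess N mark)
    (M : ℕ) (v : ℂ) (hv : ‖v‖ ≤ 1) (t : ℝ≥0) :
    (∀ᵐ ω ∂P, ∃ n, M < DelayedPassage.obsValue A Δ n ω) ∧
    Integrable (DelayedPassage.exitVariable A Δ M v t) P ∧
    ∫ ω, DelayedPassage.exitVariable A Δ M v t ω ∂P =
      DelayedPassage.closedForm a lam mu t (DelayedPassage.jointTransform A Δ P v 0) v (M + 1) := by
  subst hA
  obtain ⟨hint, hsum⟩ := hmodel.integral_exitVariable ha0 ha1 hlam hmu M hv t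
  refine ⟨hmodel.ae_exists_lt_obsValue ha0 ha1 hlam hmu M, hint, ?_⟩
  rw [DelayedPassage.closedForm_eq_sum ha1 (by exact_mod_cast hlam) hmu]
  have hγ := hmodel.hasSum_jointTransform ha0 ha1 hlam hmu hv
  set γ := DelayedPassage.jointTransform (DelayedPassage.markedProcess N mark) Δ P v 0
  let g : ℕ → ℂ := fun i => if i ≤ M then v ^ i * (DelayedPassage.occupation a lam mu t i : ℂ) *
    (γ - ∑ k ∈ Finset.range (M + 1 - i),
      (DelayedPassage.incrementProb a lam mu k : ℂ) * v ^ k) else 0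
  -- For fixed `i ≤ M` the admissible jumps are `k ≥ M + 1 - i`: the full generating function `γ`
  -- minus its first `M + 1 - i` terms.
  have hfib : ∀ i, HasSum (fun k => if i ≤ M ∧ M < i + k then
      (DelayedPassage.occupation a lam mu t i : ℂ) * DelayedPassage.incrementProb a lam mu k *
        v ^ (i + k) else 0) (g i) := by
    intro i
    by_cases hi : i ≤ M
    · have hfin : HasSum (fun k => if k ∈ Finset.range (M + 1 - i) then
          (DelayedPassage.incrementProb a lam mu k : ℂ) * v ^ k else 0)
          (∑ k ∈ Finset.range (M + 1 - i),
            (DelayedPassage.incrementProb a lam mu k : ℂ) * v ^ k) := by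
        have h1 := hasSum_sum_of_ne_finset_zero (f := fun k => if k ∈ Finset.range (M + 1 - i) then
          (DelayedPassage.incrementProb a lam mu k : ℂ) * v ^ k else 0)
          (s := Finset.range (M + 1 - i)) (L := .unconditional ℕ) (fun k hk => if_neg hk)
        rwa [Finset.sum_congr rfl fun k hk => if_pos hk] at h1
      have h2 := (hγ.sub hfin).mul_left (v ^ i * (DelayedPassage.occupation a lam mu t i : ℂ))
      simp only [g, if_pos hi]
      have hfun : ∀ k, v ^ i * (DelayedPassage.occupation a lam mu t i : ℂ) *
          ((DelayedPassage.incrementProb a lam mu k : ℂ) * v ^ k -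
            if k ∈ Finset.range (M + 1 - i) then
              (DelayedPassage.incrementProb a lam mu k : ℂ) * v ^ k else 0) =
          if i ≤ M ∧ M < i + k then (DelayedPassage.occupation a lam mu t i : ℂ) *
            DelayedPassage.incrementProb a lam mu k * v ^ (i + k) else 0 := by
        intro k
        by_cases hk : M < i + k
        · have hk' : k ∉ Finset.range (M + 1 - i) := by simp only [Finset.mem_range]; omega
          rw [if_neg hk', if_pos ⟨hi, hk⟩]
          ring
        · have hk' : k ∈ Finset.range (M + 1 - i) := by simp only [Finset.mem_range]; omega
          rw [if_pos hk', if_neg (fun hc => hk hc.2)]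
          ring
      simp only [hfun] at h2
      exact h2
    · simp only [g, hi, false_and, if_false]
      exact hasSum_zero
  have hg := hsum.prod_fiberwise hfib
  have hg' := hasSum_sum_of_ne_finset_zero (f := g) (s := Finset.range (M + 1))
    (L := .unconditional ℕ) (fun i hi => if_neg (by simpa [Nat.lt_succ_iff] using hi))
  rw [hg.unique hg']
  exact Finset.sum_congr rfl fun i hi => if_pos (Finset.mem_range_succ_iff.1 hi)
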